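/- Let $U\subseteq\mathbb R$ be open and let $h,c,p,s\in C^\infty(U)$ with $c$ nowhere zero on $U$. All differential expressions below are polynomials in $\varepsilon,x,t,u_x,u_{xx},\dots$ whose coefficients are smooth functions of $u\in U$; $\frac{d}{dx}=\partial_x+\sum_{k\ge0}u^{(k+1)}\frac{\partial}{\partial u^{(k)}}$ is the total derivative, $\mathcal E(L)=\sum_{k\ge0}(-1)^k\frac{d^k}{dx^k}\frac{\partial L}{\partial u^{(k)}}$ the Euler–Lagrange operator, and $\frac{\delta}{\delta u}\int L\,dx:=\mathcal E(L)$. For $a\in C^\infty(U)$ put $$D(a)=a-\tfrac{\varepsilon^2}{2}c_a u_x^2+\varepsilon^4\big(p_a u_{xx}^2+s_a u_x^4\big),\qquad c_a=c\,a''',\qquad p_a=p\,a'''+\tfrac{3}{10}c^2a^{(4)},$$ $$s_a=s\,a'''-\tfrac{cc''}{8}a^{(4)}-\tfrac{cc'}{8}a^{(5)}-\tfrac{c^2}{24}a^{(6)}-\tfrac{p'}{6}a^{(4)}-\tfrac p6a^{(5)},$$ and let $H_h=\int D(h)\,dx$, the Hamiltonian of $u_t=\frac{d}{dx}\frac{\delta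 H_h}{\delta u}$. Suppose that $p=\frac35cc'+\lambda c^3$ for a constant $\lambda\in\mathbb R$. Let $r'=\frac1c$, $q'=\frac{h''}{c}$, and $$e=\frac12\Big[\tfrac{53}{24}\tfrac{c''(c')^2}{c^2}-\tfrac{8}{15}\tfrac{(c')^4}{c^3}+\tfrac{s'}{c}-\tfrac{157}{120}\tfrac{(c'')^2}{c}-5\tfrac{sc'}{c^2}-\tfrac{173}{120}\tfrac{c'c'''}{c}+\tfrac5{12}c^{(4)}+\lambda\Big(-\tfrac{13}{2}c''c'+\tfrac{2(c')^3}{c}+\tfrac{11}{6}cc'''\Big)\Big].$$ For $f,f_1,f_2\in C^\infty(U)$ let $$S_f=\int\big(x\,D(r)+t\,D(q)+\varepsilon^4e(u)u_x^3\big)dx-H_f^\varepsilon,$$ where $H^\varepsilon_f$ is the truncation at order $\varepsilon^4$ of $\int\big(D(f)+\varepsilon^2D(f_1)+\varepsilon^4D(f_2)\big)dx$. (1) For all $f,f_1,f_2\in C^\infty(U)$ the functional $S_f$ is conserved up to $O(\varepsilon^6)$: there is a differential polynomial $R$ as above (polynomial in $\varepsilon$) with $$\partial_t\Big(\frac{\delta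 S_f}{\delta u}\Big)+\mathcal E\Big(\frac{\delta S_f}{\delta u}\,\frac{d}{dx}\frac{\delta H_h}{\delta u}\Big)=\varepsilon^6R .$$ (2) Let moreover $\varphi$ be a real function, smooth on an open set $I\subseteq\mathbb R$, with $\varphi(I)=U$ and $c(\varphi(x))f'(\varphi(x))=x$ for all $x\in I$ (so that $(cf')'$ does not vanish on $U$). Write $w=\frac{1}{(cf')'}$, and suppose that on $U$ $$f_1'=\frac1{2c}\,\big(c\,w\big)'',\qquad f_2'=\frac1c\,\hat f_2'',$$ where $$\begin{aligned}\hat f_2=\;&\frac{p}{2c}\Big[c\,w^2w''+c'\,(w^3)'\Big]-s\,w^3-\tfrac16c^2w^2w'''-\tfrac5{24}cc'w^2w''\\ &+\Big[\tfrac{49}{120}cc'c''f'-\tfrac1{10}c^3f^{(4)}-\tfrac1{10}c^2c'''f'-\tfrac35(c')^3f'+\tfrac{11}{60}c^2c'f'''+\tfrac{11}{30}c(c')^2f''-\tfrac38c^2c''f''\Big]w^3w'\\ &+\Big[\tfrac12(c')^2f'''+\tfrac12c'c''f''-\tfrac14cc''f'''-\tfrac14cc'''f''+\tfrac1{12}c'c'''f'-\tfrac1{24}c^2f^{(5)}-\tfrac1{24}cc^{(4)}f'\Big]c\,w^4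 .\end{aligned}$$ Then $$\frac{\delta S_f}{\delta u}\Big|_{t=0,\;u=\varphi(x)}=0$$ for all $x\in I$ and all $\varepsilon\in\mathbb R$, where $u^{(k)}$ is replaced by $\varphi^{(k)}(x)$. -/

import Mathlib

open scoped ContDiff Ring

noncomputable section

namespace StringEq

/-! ### Smooth functions of one variable on an open set -/

/-- The algebra of smooth real functions on an open set `U` of the real line. -/
def smoothSubalgebra (U : TopologicalSpace.Opens ℝ) : Subalgebra ℝ (U → ℝ) where
  carrier := {a | ∃ g : ℝ → ℝ, ContDiffOn ℝ ∞ g U ∧ ∀ v : U, g v = a v}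
  mul_mem' := by
    rintro a b ⟨g, hg, hga⟩ ⟨k, hk, hkb⟩
    exact ⟨fun y => g y * k y, hg.mul hk, fun v => by simp [hga, hkb]⟩
  add_mem' := by
    rintro a b ⟨g, hg, hga⟩ ⟨k, hk, hkb⟩
    exact ⟨fun y => g y + k y, hg.add hk, fun v => by simp [hga, hkb]⟩
  algebraMap_mem' := fun y => ⟨fun _ => y, contDiffOn_const, fun _ => rfl⟩

/-- The ring `C^∞(U)`. -/
def SmoothFun (U : TopologicalSpace.Opens ℝ) : Type := smoothSubalgebra U

instance (U : TopologicalSpace.Opens ℝ) : CommRing (SmoothFun U) :=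
  inferInstanceAs (CommRing (smoothSubalgebra U))

instance (U : TopologicalSpace.Opens ℝ) : Algebra ℝ (SmoothFun U) :=
  inferInstanceAs (Algebra ℝ (smoothSubalgebra U))

instance (U : TopologicalSpace.Opens ℝ) : CoeFun (SmoothFun U) (fun _ => U → ℝ) :=
  ⟨fun a => a.1⟩

variable {U : TopologicalSpace.Opens ℝ}

@[ext]
theorem SmoothFun.ext {a b : SmoothFun U} (hab : ∀ v : U, a v = b v) : a = b :=
  Subtype.ext (funext hab)

/-- Evaluation of smooth functions at a point of `U`, as a ring homomorphism. -/
def SmoothFun.evalHom (v : U) : SmoothFun U →+* ℝ where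
  toFun a := a v
  map_one' := rfl
  map_mul' _ _ := rfl
  map_zero' := rfl
  map_add' _ _ := rfl

theorem SmoothFun.add_apply (a b : SmoothFun U) (v : U) : (a + b) v = a v + b v := rfl

theorem SmoothFun.mul_apply (a b : SmoothFun U) (v : U) : (a * b) v = a v * b v := rfl

theorem SmoothFun.smul_apply (y : ℝ) (a : SmoothFun U) (v : U) : (y • a) v = y * a v := rfl

/-- A function on the line restricting to a given smooth function on `U` (its values off `U` are
irrelevant). -/
def SmoothFun.lift (a : SmoothFun U) : ℝ → ℝ := Classical.choose a.2

theorem SmoothFun.lift_contDiffOn (a : SmoothFun U) : ContDiffOn ℝ ∞ a.lift U :=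
  (Classical.choose_spec a.2).1

theorem SmoothFun.lift_apply (a : SmoothFun U) (v : U) : a.lift v = a v :=
  (Classical.choose_spec a.2).2 v

theorem SmoothFun.lift_differentiableAt (a : SmoothFun U) (v : U) :
    DifferentiableAt ℝ a.lift v :=
  (a.lift_contDiffOn.contDiffAt (U.isOpen.mem_nhds v.2)).differentiableAt (by simp)

/-- The derivative may be computed with any function that agrees with `a` on `U`. -/
theorem SmoothFun.deriv_lift (a : SmoothFun U) (g : ℝ → ℝ) (hg : ∀ v : U, g v = a v) (v : U) :
    deriv a.lift v = deriv g v := by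
  apply Filter.EventuallyEq.deriv_eq
  filter_upwards [U.isOpen.mem_nhds v.2] with y hy
  rw [a.lift_apply ⟨y, hy⟩, ← hg ⟨y, hy⟩]

/-- Differentiation of smooth functions on `U`, as a derivation of the ring `C^∞(U)`. -/
def ddu : Derivation ℝ (SmoothFun U) (SmoothFun U) :=
  Derivation.mk'
    { toFun := fun a => ⟨fun v => deriv a.lift v, deriv a.lift,
        ((contDiffOn_infty_iff_deriv_of_isOpen U.isOpen).1 a.lift_contDiffOn).2, fun _ => rfl⟩
      map_add' := by
        intro a b
        ext v
        change deriv (a + b).lift v = deriv a.lift v + deriv b.lift v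
        rw [SmoothFun.deriv_lift (a + b) (fun y => a.lift y + b.lift y)
          (fun w => by simp only [SmoothFun.lift_apply, SmoothFun.add_apply])]
        exact deriv_fun_add (a.lift_differentiableAt v) (b.lift_differentiableAt v)
      map_smul' := by
        intro y a
        ext v
        change deriv (y • a).lift v = y * deriv a.lift v
        rw [SmoothFun.deriv_lift (y • a) (fun z => y * a.lift z)
          (fun w => by simp only [SmoothFun.lift_apply, SmoothFun.smul_apply])]
        exact deriv_const_mul y (a.lift_differentiableAt v) }
    (by
      intro a b
      ext v
      change deriv (a * b).lift v = a v * deriv b.lift v + b v * deriv a.lift v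
      rw [SmoothFun.deriv_lift (a * b) (fun y => a.lift y * b.lift y)
        (fun w => by simp only [SmoothFun.lift_apply, SmoothFun.mul_apply])]
      rw [deriv_fun_mul (a.lift_differentiableAt v) (b.lift_differentiableAt v),
        a.lift_apply, b.lift_apply]
      ring)

/-- `ddu` is the usual derivative. -/
theorem ddu_apply (a : SmoothFun U) (g : ℝ → ℝ) (hg : ∀ v : U, g v = a v) (v : U) :
    ddu a v = deriv g v :=
  a.deriv_lift g hg v

/-- The `n`-th derivative of a smooth function on `U`. -/
def dn (n : ℕ) (a : SmoothFun U) : SmoothFun U := (fun b => ddu b)^[n] a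

/-- A nowhere vanishing smooth function is a unit, so that `a⁻¹ʳ` is its pointwise inverse. -/
theorem SmoothFun.inverse_apply (a : SmoothFun U) (ha : ∀ v, a v ≠ 0) :
    IsUnit a ∧ ∀ v, (a⁻¹ʳ : SmoothFun U) v = (a v)⁻¹ := by
  have hb : ∃ b : SmoothFun U, a * b = 1 ∧ ∀ v, b v = (a v)⁻¹ := by
    refine ⟨⟨fun v => (a v)⁻¹, fun y => (a.lift y)⁻¹, a.lift_contDiffOn.inv ?_, ?_⟩, ?_, ?_⟩
    · intro y hy
      rw [a.lift_apply ⟨y, hy⟩]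
      exact ha _
    · intro v
      simp only [a.lift_apply]
    · ext v
      exact mul_inv_cancel₀ (ha v)
    · intro v
      rfl
  obtain ⟨b, hab, hbv⟩ := hb
  have hu : IsUnit a := IsUnit.of_mul_eq_one b hab
  refine ⟨hu, fun v => ?_⟩
  have : (a⁻¹ʳ : SmoothFun U) = b := by
    have h1 := Ring.inverse_mul_cancel a hu
    calc (a⁻¹ʳ : SmoothFun U) = a⁻¹ʳ * (a * b) := by rw [hab, mul_one]
      _ = b := by rw [← mul_assoc, h1, one_mul]
  rw [this, hbv]

/-! ### Differential polynomials -/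

/-- The formal variables: `ε`, `x`, `t` and the derivatives of `u`. The variable `jet k` stands for
`u^(k+1)`; the variable `u` itself is the argument of the coefficients, which are elements of
`C^∞(U)`. -/
inductive JetVar : Type
  | eps : JetVar
  | x : JetVar
  | t : JetVar
  | jet : ℕ → JetVar

/-- Differential polynomials in `ε, x, t, u_x, u_xx, …` whose coefficients are smooth functions of
`u ∈ U`. They are the densities of the formal local functionals. -/
abbrev DiffPoly (U : TopologicalSpace.Opens ℝ) : Type := MvPolynomial JetVar (SmoothFun U)

/-- The density given by a function of `u`. -/
abbrev cf (a : SmoothFun U) : DiffPoly U := MvPolynomial.C a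

/-- The formal parameter `ε`. -/
abbrev eps : DiffPoly U := MvPolynomial.X JetVar.eps

/-- The space variable `x`. -/
abbrev xv : DiffPoly U := MvPolynomial.X JetVar.x

/-- The time variable `t`. -/
abbrev tv : DiffPoly U := MvPolynomial.X JetVar.t

/-- The first derivative `u_x`. -/
abbrev ux : DiffPoly U := MvPolynomial.X (JetVar.jet 0)

/-- The second derivative `u_xx`. -/
abbrev uxx : DiffPoly U := MvPolynomial.X (JetVar.jet 1)

/-- Coefficientwise differentiation, as a function. -/
def coeffDerivFun (L : DiffPoly U) : DiffPoly U :=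
  ∑ m ∈ L.support, MvPolynomial.monomial m (ddu (L.coeff m))

theorem coeff_coeffDerivFun (L : DiffPoly U) (m : JetVar →₀ ℕ) :
    (coeffDerivFun L).coeff m = ddu (L.coeff m) := by
  classical
  rw [coeffDerivFun, MvPolynomial.coeff_sum]
  simp only [MvPolynomial.coeff_monomial]
  rw [Finset.sum_ite_eq' L.support m]
  split_ifs with hm
  · rfl
  · rw [MvPolynomial.notMem_support_iff.1 hm, map_zero]

/-- The partial derivative `∂/∂u`: it differentiates the coefficients and treats `ε`, `x`, `t`,
`u_x`, `u_xx`, … as constants. -/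
def partialU : Derivation ℝ (DiffPoly U) (DiffPoly U) :=
  Derivation.mk'
    { toFun := coeffDerivFun
      map_add' := by
        intro L M
        ext1 m
        simp only [coeff_coeffDerivFun, MvPolynomial.coeff_add, map_add]
      map_smul' := by
        intro y L
        ext1 m
        simp only [coeff_coeffDerivFun, MvPolynomial.coeff_smul, RingHom.id_apply]
        exact ddu.map_smul y _ }
    (by
      classical
      intro L M
      ext1 m
      simp only [LinearMap.coe_mk, AddHom.coe_mk, smul_eq_mul, MvPolynomial.coeff_add,
        coeff_coeffDerivFun, MvPolynomial.coeff_mul, map_sum, Derivation.leibniz]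
      rw [Finset.sum_add_distrib]
      congr 1
      exact Finset.sum_nbij' Prod.swap Prod.swap
        (by simp [add_comm]) (by simp [add_comm]) (by simp) (by simp) (by simp))

theorem partialU_C (a : SmoothFun U) : partialU (cf a) = cf (ddu a) := by
  classical
  ext1 m
  change (coeffDerivFun (cf a)).coeff m = _
  rw [coeff_coeffDerivFun, MvPolynomial.coeff_C, MvPolynomial.coeff_C]
  split_ifs
  · rfl
  · exact map_zero _

theorem partialU_X (i : JetVar) : partialU (MvPolynomial.X i : DiffPoly U) = 0 := by
  classical
  ext1 m
  change (coeffDerivFun (MvPolynomial.X i : DiffPoly U)).coeff m = _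
  rw [coeff_coeffDerivFun, MvPolynomial.coeff_X, MvPolynomial.coeff_zero]
  split_ifs
  · exact Derivation.map_one_eq_zero _
  · exact map_zero _

/-- The partial derivative `∂/∂u^(k)`, where `u^(0) = u`. -/
def partialJet : ℕ → Derivation ℝ (DiffPoly U) (DiffPoly U)
  | 0 => partialU
  | k + 1 => (MvPolynomial.pderiv (JetVar.jet k)).restrictScalars ℝ

/-- The partial derivative `∂_t` with respect to the explicit time variable. -/
def partialT (L : DiffPoly U) : DiffPoly U := MvPolynomial.pderiv JetVar.t L

/-- The total derivative `d/dx = ∂_x + ∑_k u^(k+1) ∂/∂u^(k)`. -/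
def totalD : Derivation ℝ (DiffPoly U) (DiffPoly U) :=
  (ux : DiffPoly U) • partialU +
    (MvPolynomial.mkDerivation (SmoothFun U) (fun i : JetVar => match i with
      | JetVar.eps => (0 : DiffPoly U)
      | JetVar.x => 1
      | JetVar.t => 0
      | JetVar.jet k => MvPolynomial.X (JetVar.jet (k + 1)))).restrictScalars ℝ

/-- The Euler–Lagrange operator `∑_k (-1)^k (d/dx)^k ∂/∂u^(k)`. For a functional with density `L`,
possibly depending on `x` and `t`, it gives the variational derivative. -/
def euler (L : DiffPoly U) : DiffPoly U :=
  ∑ᶠ k : ℕ, (-1) ^ k * (fun M : DiffPoly U => totalD M)^[k] (partialJet k L)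

/-- Only finitely many terms of the Euler–Lagrange operator are nonzero. -/
theorem euler_support_finite (L : DiffPoly U) :
    (Function.support fun k : ℕ =>
      (-1) ^ k * (fun M : DiffPoly U => totalD M)^[k] (partialJet k L)).Finite := by
  classical
  have hz : ∀ k : ℕ, (fun M : DiffPoly U => totalD M)^[k] 0 = 0 := by
    intro k
    induction k with
    | zero => rfl
    | succ k ih => rw [Function.iterate_succ_apply', ih, map_zero]
  have hfin : {k : ℕ | JetVar.jet k ∈ L.vars}.Finite :=
    Set.Finite.preimage (f := JetVar.jet) (fun a _ b _ hab => by simpa using hab)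
      L.vars.finite_toSet
  refine ((hfin.image Nat.succ).insert 0).subset ?_
  intro k hk
  rcases k with _ | k
  · exact Set.mem_insert _ _
  · refine Set.mem_insert_of_mem _ ⟨k, ?_, rfl⟩
    by_contra hn
    apply hk
    have : partialJet (k + 1) L = 0 := MvPolynomial.pderiv_eq_zero_of_notMem_vars hn
    simp only [this, hz, mul_zero]

/-! ### The `D`-operator, the Hamiltonian and the special functionals -/

/-- The coefficient `c_a = c a'''`. -/
def cCoeff (c a : SmoothFun U) : SmoothFun U := c * dn 3 a

/-- The coefficient `p_a = p a''' + (3/10) c² a''''`. -/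
def pCoeff (c p a : SmoothFun U) : SmoothFun U :=
  p * dn 3 a + (3 / 10 : ℝ) • (c ^ 2 * dn 4 a)

/-- The coefficient `s_a`. -/
def sCoeff (c p s a : SmoothFun U) : SmoothFun U :=
  s * dn 3 a - (1 / 8 : ℝ) • (c * dn 2 c * dn 4 a) - (1 / 8 : ℝ) • (c * dn 1 c * dn 5 a)
    - (1 / 24 : ℝ) • (c ^ 2 * dn 6 a) - (1 / 6 : ℝ) • (dn 1 p * dn 4 a)
    - (1 / 6 : ℝ) • (p * dn 5 a)

/-- The coefficient of `ε²` in the `D`-operator. -/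
def dop2 (c a : SmoothFun U) : DiffPoly U := -((1 / 2 : ℝ) • (cf (cCoeff c a) * ux ^ 2))

/-- The coefficient of `ε⁴` in the `D`-operator. -/
def dop4 (c p s a : SmoothFun U) : DiffPoly U :=
  cf (pCoeff c p a) * uxx ^ 2 + cf (sCoeff c p s a) * ux ^ 4

/-- The operator `D_{(c,p,s)}`; `dop c p s h` is the density of the Hamiltonian `H_h`. -/
def dop (c p s a : SmoothFun U) : DiffPoly U :=
  cf a + eps ^ 2 * dop2 c a + eps ^ 4 * dop4 c p s a

/-- The truncation at order `ε⁴` of the density `D_{(c,p,s)}(f + ε² f₁ + ε⁴ f₂)`. -/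
def dopTrunc (c p s f f₁ f₂ : SmoothFun U) : DiffPoly U :=
  cf f + eps ^ 2 * (cf f₁ + dop2 c f) + eps ^ 4 * (cf f₂ + dop2 c f₁ + dop4 c p s f)

/-- `dopTrunc` differs from `D_{(c,p,s)}(f + ε² f₁ + ε⁴ f₂)` by terms of order `ε⁶`. -/
theorem dopTrunc_spec (c p s f f₁ f₂ : SmoothFun U) :
    dop c p s f + eps ^ 2 * dop c p s f₁ + eps ^ 4 * dop c p s f₂ =
      dopTrunc c p s f f₁ f₂ +
        eps ^ 6 * (dop4 c p s f₁ + dop2 c f₂ + eps ^ 2 * dop4 c p s f₂) := by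
  unfold dop dopTrunc
  ring

/-- The function `e` in the density of the special functional `S₀`. -/
def gaugeE (c s : SmoothFun U) (lam : ℝ) : SmoothFun U :=
  (1 / 2 : ℝ) • (
    (53 / 24 : ℝ) • (dn 2 c * dn 1 c ^ 2 * c⁻¹ʳ ^ 2)
    - (8 / 15 : ℝ) • (dn 1 c ^ 4 * c⁻¹ʳ ^ 3)
    + dn 1 s * c⁻¹ʳ
    - (157 / 120 : ℝ) • (dn 2 c ^ 2 * c⁻¹ʳ)
    - (5 : ℝ) • (s * dn 1 c * c⁻¹ʳ ^ 2)
    - (173 / 120 : ℝ) • (dn 1 c * dn 3 c * c⁻¹ʳ)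
    + (5 / 12 : ℝ) • dn 4 c
    + lam • (-((13 / 2 : ℝ) • (dn 2 c * dn 1 c)) + (2 : ℝ) • (dn 1 c ^ 3 * c⁻¹ʳ)
        + (11 / 6 : ℝ) • (c * dn 3 c)))

/-- The density `x D(r) + t D(q) + ε⁴ e(u) u_x³` of the functional `S₀`. -/
def densityS0 (c p s r q : SmoothFun U) (lam : ℝ) : DiffPoly U :=
  xv * dop c p s r + tv * dop c p s q + eps ^ 4 * (cf (gaugeE c s lam) * ux ^ 3)

/-- The density of the functional `S_f`. -/
def densityS (c p s r q f f₁ f₂ : SmoothFun U) (lam : ℝ) : DiffPoly U :=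
  densityS0 c p s r q lam - dopTrunc c p s f f₁ f₂

/-- The reciprocal `1 / (c f')'`. -/
def recip (c f : SmoothFun U) : SmoothFun U := (ddu (c * ddu f))⁻¹ʳ

/-- The explicit function `f̂₂`. -/
def fHat₂ (c p s f : SmoothFun U) : SmoothFun U :=
  (1 / 2 : ℝ) • (p * c⁻¹ʳ *
      (c * recip c f ^ 2 * dn 2 (recip c f) + dn 1 c * dn 1 (recip c f ^ 3)))
  - s * recip c f ^ 3
  - (1 / 6 : ℝ) • (c ^ 2 * recip c f ^ 2 * dn 3 (recip c f))
  - (5 / 24 : ℝ) • (c * dn 1 c * recip c f ^ 2 * dn 2 (recip c f))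
  + ((49 / 120 : ℝ) • (c * dn 1 c * dn 2 c * dn 1 f)
      - (1 / 10 : ℝ) • (c ^ 3 * dn 4 f)
      - (1 / 10 : ℝ) • (c ^ 2 * dn 3 c * dn 1 f)
      - (3 / 5 : ℝ) • (dn 1 c ^ 3 * dn 1 f)
      + (11 / 60 : ℝ) • (c ^ 2 * dn 1 c * dn 3 f)
      + (11 / 30 : ℝ) • (c * dn 1 c ^ 2 * dn 2 f)
      - (3 / 8 : ℝ) • (c ^ 2 * dn 2 c * dn 2 f)) * (recip c f ^ 3 * dn 1 (recip c f))
  + ((1 / 2 : ℝ) • (dn 1 c ^ 2 * dn 3 f)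
      + (1 / 2 : ℝ) • (dn 1 c * dn 2 c * dn 2 f)
      - (1 / 4 : ℝ) • (c * dn 2 c * dn 3 f)
      - (1 / 4 : ℝ) • (c * dn 3 c * dn 2 f)
      + (1 / 12 : ℝ) • (dn 1 c * dn 3 c * dn 1 f)
      - (1 / 24 : ℝ) • (c ^ 2 * dn 5 f)
      - (1 / 24 : ℝ) • (c * dn 4 c * dn 1 f)) * (c * recip c f ^ 4)

/-! ### Evaluation along a function -/

/-- The value of a differential polynomial at the point `x`, the time `t` and the parameter `e`,
with `u = φ(x)` and `u^(k)` replaced by the `k`-th derivative of `φ` at `x`. -/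
def evalAt (φ : ℝ → ℝ) (x t e : ℝ) (hx : φ x ∈ U) : DiffPoly U →+* ℝ :=
  MvPolynomial.eval₂Hom
    (SmoothFun.evalHom ⟨φ x, hx⟩)
    (fun i => match i with
      | JetVar.eps => e
      | JetVar.x => x
      | JetVar.t => t
      | JetVar.jet k => iteratedDeriv (k + 1) φ x)

end StringEq

end

set_option linter.unusedSimpArgs false

noncomputable section

namespace StringEq

variable {U : TopologicalSpace.Opens ℝ}

/-! ### Rules of calculus -/

/-! Conservation. Modulo `ε⁶`, each product `E(D(a)) · d/dx E(D(h))` is `a' h'' u_x` plus the total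
derivative of an explicit flux (`euler_dop_mul_totalD`), and the Euler–Lagrange operator annihilates
both pieces (`euler_totalD`, `euler_C_mul_ux`). This disposes of `H_f` and of `t D(q)`. For `x D(r)`
the flux is `F = q + ε² flux2 + ε⁴ flux4`, since `r' h'' = q'`, and `x F' = (x F)' - F`. The
leftover `-F`, together with the `x`-free terms that `x D(r)` and `e u_x³` add to the variational
derivative, equals `-D(q)` up to a total derivative (`totalD_fluxX2`, `totalD_fluxX4`). Its
Euler–Lagrange image `-E(D(q))` cancels the explicit `t`-derivative of `δS_f/δu`. The form of `p`
and the choice of `e` enter only in the `ε⁴` identity.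

Stationarity. Differentiating `c(φ) f'(φ) = x` gives `φ' = w(φ)`, so every further derivative of `φ`
is obtained by applying `w d/du` to a function of `u` (`iteratedDeriv_succ_eq`). Along `φ` the
variable `x` is `c f'`, and at `t = 0` each order in `ε` of `δS_f/δu` becomes a function of `u`.
Order `ε⁰` is `f' = x r'`; the orders `ε²` and `ε⁴` vanish by the formulas for `f₁'` and `f₂'`
(`stationary_eps_two`, `stationary_eps_four`).

The long identities are verified pointwise: after evaluation at a point of `U` and at given values
of the jet variables they are polynomial or rational identities over `ℝ`. -/

theorem totalD_C (a : SmoothFun U) : totalD (cf a) = cf (ddu a) * ux := by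
  simp [totalD, partialU_C, mul_comm]

theorem totalD_jet (k : ℕ) :
    totalD (MvPolynomial.X (JetVar.jet k) : DiffPoly U) = MvPolynomial.X (JetVar.jet (k + 1)) := by
  simp [totalD, partialU_X]

theorem totalD_x : totalD (xv : DiffPoly U) = 1 := by
  simp [totalD, partialU_X]

theorem totalD_t : totalD (tv : DiffPoly U) = 0 := by
  simp [totalD, partialU_X]

theorem totalD_eps : totalD (eps : DiffPoly U) = 0 := by
  simp [totalD, partialU_X]

theorem partialJet_zero_C (a : SmoothFun U) : partialJet 0 (cf a) = cf (ddu a) :=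
  partialU_C a

theorem partialJet_zero_X (i : JetVar) : partialJet 0 (MvPolynomial.X i : DiffPoly U) = 0 :=
  partialU_X i

theorem partialJet_succ_C (k : ℕ) (a : SmoothFun U) : partialJet (k + 1) (cf a) = 0 := by
  simp [partialJet]

theorem partialJet_succ_jet (k j : ℕ) :
    partialJet (k + 1) (MvPolynomial.X (JetVar.jet j) : DiffPoly U) = if j = k then 1 else 0 := by
  classical
  simp only [partialJet, Derivation.restrictScalars_apply, MvPolynomial.pderiv_X, Pi.single_apply,
    JetVar.jet.injEq]

theorem partialJet_x (k : ℕ) : partialJet k (xv : DiffPoly U) = 0 := by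
  classical
  cases k with
  | zero => exact partialU_X _
  | succ k => simp [partialJet, MvPolynomial.pderiv_X]

theorem partialJet_t (k : ℕ) : partialJet k (tv : DiffPoly U) = 0 := by
  classical
  cases k with
  | zero => exact partialU_X _
  | succ k => simp [partialJet, MvPolynomial.pderiv_X]

theorem partialJet_eps (k : ℕ) : partialJet k (eps : DiffPoly U) = 0 := by
  classical
  cases k with
  | zero => exact partialU_X _
  | succ k => simp [partialJet, MvPolynomial.pderiv_X]

/-- A derivation of the ring of differential polynomials is determined by its values on
coefficients and variables. -/
theorem derivation_ext {A B : Derivation ℝ (DiffPoly U) (DiffPoly U)}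
    (hC : ∀ a, A (cf a) = B (cf a))
    (hX : ∀ i, A (MvPolynomial.X i) = B (MvPolynomial.X i)) : A = B := by
  ext1 L
  induction L using MvPolynomial.induction_on with
  | C a => exact hC a
  | add L M hL hM => rw [map_add, map_add, hL, hM]
  | mul_X L i hL => rw [Derivation.leibniz, Derivation.leibniz, hL, hX]

theorem partialJet_zero_totalD (L : DiffPoly U) :
    partialJet 0 (totalD L) = totalD (partialJet 0 L) := by
  have key : ⁅(partialJet 0 : Derivation ℝ (DiffPoly U) (DiffPoly U)),
      (totalD : Derivation ℝ (DiffPoly U) (DiffPoly U))⁆ = 0 := by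
    apply derivation_ext
    · intro a
      simp [Derivation.commutator_apply, totalD_C, partialJet_zero_C, partialJet_zero_X, mul_comm]
    · rintro (_ | _ | _ | k)
      · simp [Derivation.commutator_apply, totalD_eps, partialJet_zero_X]
      · simp [Derivation.commutator_apply, totalD_x, partialJet_zero_X]
      · simp [Derivation.commutator_apply, totalD_t, partialJet_zero_X]
      · simp [Derivation.commutator_apply, totalD_jet, partialJet_zero_X]
  have := congrArg (fun A : Derivation ℝ (DiffPoly U) (DiffPoly U) => A L) key
  simpa [Derivation.commutator_apply, sub_eq_zero] using this

/-- The commutator of `∂/∂u^(k+1)` with `d/dx` is `∂/∂u^(k)`, because `u^(k+1)` occurs in `d/dx` as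
the coefficient of `∂/∂u^(k)`. Commutators of derivations are derivations, so checking generators
suffices. -/
theorem partialJet_succ_totalD (k : ℕ) (L : DiffPoly U) :
    partialJet (k + 1) (totalD L) = totalD (partialJet (k + 1) L) + partialJet k L := by
  have key : ⁅(partialJet (k + 1) : Derivation ℝ (DiffPoly U) (DiffPoly U)),
      (totalD : Derivation ℝ (DiffPoly U) (DiffPoly U))⁆
      = partialJet k := by
    apply derivation_ext
    · intro a
      cases k with
      | zero =>
        simp [Derivation.commutator_apply, totalD_C, partialJet_zero_C, partialJet_succ_C,
          partialJet_succ_jet]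
      | succ k =>
        simp [Derivation.commutator_apply, totalD_C, partialJet_succ_C, partialJet_succ_jet]
    · rintro (_ | _ | _ | j)
      · simp [Derivation.commutator_apply, totalD_eps, partialJet_eps]
      · simp [Derivation.commutator_apply, totalD_x, partialJet_x]
      · simp [Derivation.commutator_apply, totalD_t, partialJet_t]
      · rw [Derivation.commutator_apply, totalD_jet, partialJet_succ_jet, partialJet_succ_jet]
        -- Since `jet j` is `u^(j+1)`, the commutator must give 1 exactly when `j + 1 = k`. For `k =
        -- 0` this never happens, in agreement with `∂/∂u` annihilating all variables.
        cases k with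
        | zero =>
          rw [partialJet_zero_X]
          split_ifs <;> simp_all
        | succ k =>
          rw [partialJet_succ_jet]
          split_ifs <;> simp_all
  have := congrArg (fun A : Derivation ℝ (DiffPoly U) (DiffPoly U) => A L) key
  simp only [Derivation.commutator_apply] at this
  rw [← this]
  ring

/-! ### The Euler–Lagrange operator -/

theorem iterate_totalD_zero (k : ℕ) :
    (fun M : DiffPoly U => totalD M)^[k] 0 = 0 := by
  induction k with
  | zero => rfl
  | succ k ih => rw [Function.iterate_succ_apply', ih, map_zero]

theorem iterate_totalD_add (k : ℕ) (L M : DiffPoly U) :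
    (fun M : DiffPoly U => totalD M)^[k] (L + M) =
      (fun M : DiffPoly U => totalD M)^[k] L + (fun M : DiffPoly U => totalD M)^[k] M := by
  induction k with
  | zero => rfl
  | succ k ih => simp only [Function.iterate_succ_apply', ih, map_add]

theorem iterate_totalD_mul (k : ℕ) (y L : DiffPoly U) (hy : totalD y = 0) :
    (fun M : DiffPoly U => totalD M)^[k] (y * L) =
      y * (fun M : DiffPoly U => totalD M)^[k] L := by
  induction k with
  | zero => rfl
  | succ k ih =>
    simp only [Function.iterate_succ_apply', ih, Derivation.leibniz, hy, smul_eq_mul, mul_zero,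
      add_zero]

theorem exists_partialJet_eq_zero (L : DiffPoly U) :
    ∃ N, ∀ k, N ≤ k → partialJet k L = 0 := by
  classical
  have hfin : {k : ℕ | JetVar.jet k ∈ L.vars}.Finite :=
    Set.Finite.preimage (f := JetVar.jet) (fun a _ b _ hab => by simpa using hab)
      L.vars.finite_toSet
  obtain ⟨N, hN⟩ := hfin.bddAbove
  -- `N` bounds the indices of the variables `jet j`, which stand for `u^(j+1)`; hence the shift,
  -- and `N + 2` for strictness.
  refine ⟨N + 2, fun k hk => ?_⟩
  obtain ⟨j, rfl⟩ : ∃ j, k = j + 1 := ⟨k - 1, by omega⟩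
  refine MvPolynomial.pderiv_eq_zero_of_notMem_vars fun hj => ?_
  have : j ≤ N := hN hj
  omega

theorem euler_eq_sum (L : DiffPoly U) (N : ℕ) (hN : ∀ k, N ≤ k → partialJet k L = 0) :
    euler L = ∑ k ∈ Finset.range N,
      (-1) ^ k * (fun M : DiffPoly U => totalD M)^[k] (partialJet k L) := by
  apply finsum_eq_sum_of_support_subset
  intro k hk
  by_contra hn
  apply hk
  have : N ≤ k := by simpa using hn
  simp only [hN k this, iterate_totalD_zero, mul_zero]

theorem euler_add (L M : DiffPoly U) : euler (L + M) = euler L + euler M := by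
  unfold euler
  rw [← finsum_add_distrib (euler_support_finite L) (euler_support_finite M)]
  simp only [map_add, iterate_totalD_add, mul_add]

theorem euler_zero : euler (0 : DiffPoly U) = 0 := by
  simpa using euler_add (0 : DiffPoly U) 0

theorem euler_neg (L : DiffPoly U) : euler (-L) = -euler L := by
  have := euler_add L (-L)
  rw [add_neg_cancel, euler_zero] at this
  exact (neg_eq_of_add_eq_zero_right this.symm).symm

theorem euler_sub (L M : DiffPoly U) : euler (L - M) = euler L - euler M := by
  rw [sub_eq_add_neg, euler_add, euler_neg, sub_eq_add_neg]

theorem euler_mul_of_const (y L : DiffPoly U) (hy : totalD y = 0)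
    (hy' : ∀ k, partialJet k y = 0) : euler (y * L) = y * euler L := by
  unfold euler
  rw [mul_finsum' _ _ (euler_support_finite L)]
  apply finsum_congr
  intro k
  rw [Derivation.leibniz, hy', smul_zero, add_zero, smul_eq_mul, iterate_totalD_mul k y _ hy]
  ring

theorem euler_t_mul (L : DiffPoly U) : euler (tv * L) = tv * euler L :=
  euler_mul_of_const _ _ totalD_t partialJet_t

theorem totalD_eps_pow (n : ℕ) : totalD (eps ^ n : DiffPoly U) = 0 := by
  rw [Derivation.leibniz_pow, totalD_eps, smul_zero, smul_zero]

theorem euler_eps_pow_mul (n : ℕ) (L : DiffPoly U) : euler (eps ^ n * L) = eps ^ n * euler L :=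
  euler_mul_of_const _ _ (totalD_eps_pow n)
    (fun k => by rw [Derivation.leibniz_pow, partialJet_eps, smul_zero, smul_zero])

/-- The Euler–Lagrange operator annihilates total derivatives. -/
theorem euler_totalD (L : DiffPoly U) : euler (totalD L) = 0 := by
  obtain ⟨N, hN⟩ := exists_partialJet_eq_zero L
  have hN' : ∀ k, N + 1 ≤ k → partialJet k (totalD L) = 0 := by
    intro k hk
    obtain ⟨j, rfl⟩ : ∃ j, k = j + 1 := ⟨k - 1, by omega⟩
    rw [partialJet_succ_totalD, hN _ (by omega), hN _ (by omega), map_zero, add_zero]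
  -- By the commutator rule the alternating sum telescopes; only the top term survives, and it
  -- vanishes once `n` exceeds the order of `L`.
  have key : ∀ n, ∑ k ∈ Finset.range (n + 1),
      (-1) ^ k * (fun M : DiffPoly U => totalD M)^[k] (partialJet k (totalD L)) =
      (-1) ^ n * (fun M : DiffPoly U => totalD M)^[n + 1] (partialJet n L) := by
    intro n
    induction n with
    | zero => simp [partialJet_zero_totalD]
    | succ n ih =>
      rw [Finset.sum_range_succ, ih, partialJet_succ_totalD, iterate_totalD_add,
        Function.iterate_succ_apply (f := fun M : DiffPoly U => totalD M) (n + 1)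
          (partialJet (n + 1) L)]
      ring
  rw [euler_eq_sum _ _ hN', key, hN _ le_rfl, iterate_totalD_zero, mul_zero]

/-- The Euler–Lagrange operator on densities that depend on `u`, `u_x` and `u_xx` only. -/
theorem euler_of_order_two (L : DiffPoly U) (hL : ∀ k, 3 ≤ k → partialJet k L = 0) :
    euler L = partialJet 0 L - totalD (partialJet 1 L) + totalD (totalD (partialJet 2 L)) := by
  rw [euler_eq_sum L 3 hL]
  simp [Finset.sum_range_succ, sub_eq_add_neg]

/-- The extra terms come from the Leibniz rule with `d/dx x = 1`: one from `-d/dx` and two equal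
ones from `(d/dx)²`. -/
theorem euler_x_mul_of_order_two (L : DiffPoly U) (hL : ∀ k, 3 ≤ k → partialJet k L = 0) :
    euler (xv * L) = xv * euler L - partialJet 1 L + 2 * totalD (partialJet 2 L) := by
  have h : ∀ k, partialJet k (xv * L) = xv * partialJet k L := by
    intro k
    rw [Derivation.leibniz, partialJet_x, smul_zero, add_zero, smul_eq_mul]
  rw [euler_of_order_two L hL, euler_of_order_two (xv * L) (fun k hk => by rw [h, hL k hk, mul_zero]),
    h, h, h]
  simp only [Derivation.leibniz, totalD_x, smul_eq_mul, map_add, mul_one]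
  ring

/-! ### Identities of differential polynomials -/

/-- Evaluation of differential polynomials at arbitrary values of the jet variables. -/
def evalJet (v : U) (ρ : JetVar → ℝ) : DiffPoly U →+* ℝ :=
  MvPolynomial.eval₂Hom (SmoothFun.evalHom v) ρ

theorem evalJet_C (v : U) (ρ : JetVar → ℝ) (a : SmoothFun U) : evalJet v ρ (cf a) = a v :=
  MvPolynomial.eval₂Hom_C _ _ _

theorem evalJet_X (v : U) (ρ : JetVar → ℝ) (i : JetVar) :
    evalJet v ρ (MvPolynomial.X i) = ρ i :=
  MvPolynomial.eval₂Hom_X' _ _ _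

/-- Fixing the point of `U` leaves a real polynomial in the jet variables, which is determined by
its values because `ℝ` is infinite. This moves identities to `ℝ`, where division by nonzero values
is available. -/
theorem DiffPoly.ext_eval {L M : DiffPoly U} (hLM : ∀ v ρ, evalJet v ρ L = evalJet v ρ M) :
    L = M := by
  have h : ∀ v : U, MvPolynomial.map (SmoothFun.evalHom v) L =
      MvPolynomial.map (SmoothFun.evalHom v) M := by
    intro v
    apply MvPolynomial.funext
    intro ρ
    rw [MvPolynomial.eval_map, MvPolynomial.eval_map]
    exact hLM v ρ
  ext m v
  have := congrArg (MvPolynomial.coeff m) (h v)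
  rwa [MvPolynomial.coeff_map, MvPolynomial.coeff_map] at this

/-! ### Pointwise calculus of smooth functions -/

theorem SmoothFun.sub_apply (a b : SmoothFun U) (v : U) : (a - b) v = a v - b v := rfl

theorem SmoothFun.neg_apply (a : SmoothFun U) (v : U) : (-a) v = -a v := rfl

theorem SmoothFun.pow_apply (a : SmoothFun U) (n : ℕ) (v : U) : (a ^ n) v = a v ^ n := rfl

theorem SmoothFun.one_apply (v : U) : (1 : SmoothFun U) v = 1 := rfl

theorem ddu_add (a b : SmoothFun U) : ddu (a + b) = ddu a + ddu b := map_add _ _ _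

theorem ddu_sub (a b : SmoothFun U) : ddu (a - b) = ddu a - ddu b := map_sub _ _ _

theorem ddu_neg (a : SmoothFun U) : ddu (-a) = -ddu a := map_neg _ _

theorem ddu_smul (y : ℝ) (a : SmoothFun U) : ddu (y • a) = y • ddu a := Derivation.map_smul _ _ _

theorem ddu_mul (a b : SmoothFun U) : ddu (a * b) = ddu a * b + a * ddu b := by
  rw [Derivation.leibniz, smul_eq_mul, smul_eq_mul]
  ring

theorem ddu_pow (a : SmoothFun U) (n : ℕ) :
    ddu (a ^ n) = (n : ℝ) • (a ^ (n - 1) * ddu a) := by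
  rw [Derivation.leibniz_pow, smul_eq_mul, Nat.cast_smul_eq_nsmul]

theorem dn_zero (a : SmoothFun U) : dn 0 a = a := rfl

theorem dn_succ (n : ℕ) (a : SmoothFun U) : dn (n + 1) a = ddu (dn n a) :=
  Function.iterate_succ_apply' _ _ _

theorem ddu_inverse (a : SmoothFun U) (ha : ∀ v, a v ≠ 0) :
    ddu a⁻¹ʳ = -(ddu a * a⁻¹ʳ ^ 2) := by
  have h1 : a⁻¹ʳ * a = 1 := Ring.inverse_mul_cancel a (a.inverse_apply ha).1
  have h2 := congrArg ddu h1
  rw [ddu_mul, Derivation.map_one_eq_zero] at h2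
  linear_combination a⁻¹ʳ * h2 - ddu a⁻¹ʳ * h1

/-! ### Differential polynomials of low order -/

/-- The third derivative `u_xxx`. -/
abbrev u3 : DiffPoly U := MvPolynomial.X (JetVar.jet 2)

/-- The fourth derivative of `u`. -/
abbrev u4 : DiffPoly U := MvPolynomial.X (JetVar.jet 3)

theorem evalJet_smul (v : U) (ρ : JetVar → ℝ) (y : ℝ) (L : DiffPoly U) :
    evalJet v ρ (y • L) = y * evalJet v ρ L := by
  have : y • L = cf (y • 1) * L := by
    rw [← MvPolynomial.smul_eq_C_mul, smul_assoc, one_smul]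
  rw [this, map_mul, evalJet_C, SmoothFun.smul_apply, SmoothFun.one_apply, mul_one]

theorem totalD_mul (L M : DiffPoly U) : totalD (L * M) = totalD L * M + L * totalD M := by
  rw [Derivation.leibniz, smul_eq_mul, smul_eq_mul]
  ring

theorem totalD_pow (L : DiffPoly U) (n : ℕ) :
    totalD (L ^ n) = (n : ℝ) • (L ^ (n - 1) * totalD L) := by
  rw [Derivation.leibniz_pow, smul_eq_mul, Nat.cast_smul_eq_nsmul]

theorem totalD_smul (y : ℝ) (L : DiffPoly U) : totalD (y • L) = y • totalD L :=
  Derivation.map_smul _ _ _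

theorem partialJet_mul (k : ℕ) (L M : DiffPoly U) :
    partialJet k (L * M) = partialJet k L * M + L * partialJet k M := by
  rw [Derivation.leibniz, smul_eq_mul, smul_eq_mul]
  ring

theorem partialJet_pow (k : ℕ) (L : DiffPoly U) (n : ℕ) :
    partialJet k (L ^ n) = (n : ℝ) • (L ^ (n - 1) * partialJet k L) := by
  rw [Derivation.leibniz_pow, smul_eq_mul, Nat.cast_smul_eq_nsmul]

theorem partialJet_smul (k : ℕ) (y : ℝ) (L : DiffPoly U) :
    partialJet k (y • L) = y • partialJet k L :=
  Derivation.map_smul _ _ _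

theorem partialJet_C_mul_ux_pow (a : SmoothFun U) (n : ℕ) :
    partialJet 0 (cf a * ux ^ n) = cf (ddu a) * ux ^ n ∧
    partialJet 1 (cf a * ux ^ n) = (n : ℝ) • (cf a * ux ^ (n - 1)) ∧
    ∀ k, 2 ≤ k → partialJet k (cf a * ux ^ n) = 0 := by
  refine ⟨?_, ?_, fun k hk => ?_⟩
  · simp [partialJet_zero_C, partialJet_zero_X, mul_comm]
  · simp only [partialJet_mul, partialJet_pow, partialJet_succ_C, partialJet_succ_jet (U := U) 0,
      if_true, mul_one, zero_mul, zero_add, mul_smul_comm]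
  · obtain ⟨j, rfl⟩ : ∃ j, k = j + 2 := ⟨k - 2, by omega⟩
    simp [partialJet_succ_C, partialJet_succ_jet (U := U) (j + 1)]

theorem partialJet_C_mul_uxx_sq (a : SmoothFun U) :
    partialJet 0 (cf a * uxx ^ 2) = cf (ddu a) * uxx ^ 2 ∧
    partialJet 1 (cf a * uxx ^ 2) = 0 ∧
    partialJet 2 (cf a * uxx ^ 2) = (2 : ℝ) • (cf a * uxx) ∧
    ∀ k, 3 ≤ k → partialJet k (cf a * uxx ^ 2) = 0 := by
  refine ⟨?_, ?_, ?_, fun k hk => ?_⟩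
  · simp [partialJet_zero_C, partialJet_zero_X, mul_comm]
  · simp [partialJet_succ_C, partialJet_succ_jet (U := U) 0]
  · simp only [partialJet_mul, partialJet_pow, partialJet_succ_C, partialJet_succ_jet (U := U) 1,
      if_true, mul_one, zero_mul, zero_add, mul_smul_comm, Nat.add_one_sub_one, pow_one,
      Nat.cast_ofNat]
  · obtain ⟨j, rfl⟩ : ∃ j, k = j + 3 := ⟨k - 3, by omega⟩
    simp [partialJet_succ_C, partialJet_succ_jet (U := U) (j + 2)]

theorem partialJet_dop2 (c a : SmoothFun U) :
    partialJet 0 (dop2 c a) = -((1 / 2 : ℝ) • (cf (ddu (cCoeff c a)) * ux ^ 2)) ∧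
    partialJet 1 (dop2 c a) = -(cf (cCoeff c a) * ux) ∧
    ∀ k, 2 ≤ k → partialJet k (dop2 c a) = 0 := by
  obtain ⟨h0, h1, h2⟩ := partialJet_C_mul_ux_pow (cCoeff c a) 2
  refine ⟨?_, ?_, fun k hk => ?_⟩
  · rw [dop2, map_neg, partialJet_smul, h0]
  · rw [dop2, map_neg, partialJet_smul, h1, smul_smul]
    norm_num
  · rw [dop2, map_neg, partialJet_smul, h2 k hk, smul_zero, neg_zero]

theorem partialJet_dop4 (c p s a : SmoothFun U) :
    partialJet 0 (dop4 c p s a) =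
      cf (ddu (pCoeff c p a)) * uxx ^ 2 + cf (ddu (sCoeff c p s a)) * ux ^ 4 ∧
    partialJet 1 (dop4 c p s a) = (4 : ℝ) • (cf (sCoeff c p s a) * ux ^ 3) ∧
    partialJet 2 (dop4 c p s a) = (2 : ℝ) • (cf (pCoeff c p a) * uxx) ∧
    ∀ k, 3 ≤ k → partialJet k (dop4 c p s a) = 0 := by
  obtain ⟨h0, h1, h2⟩ := partialJet_C_mul_ux_pow (sCoeff c p s a) 4
  obtain ⟨g0, g1, g2, g3⟩ := partialJet_C_mul_uxx_sq (pCoeff c p a)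
  refine ⟨?_, ?_, ?_, fun k hk => ?_⟩
  · rw [dop4, map_add, g0, h0]
  · rw [dop4, map_add, g1, h1, zero_add]
    norm_num
  · rw [dop4, map_add, g2, h2 2 le_rfl, add_zero]
  · rw [dop4, map_add, g3 k hk, h2 k (by omega), add_zero]

theorem euler_C (a : SmoothFun U) : euler (cf a) = cf (ddu a) := by
  rw [euler_eq_sum _ 1]
  · simp [partialJet_zero_C]
  · intro k hk
    obtain ⟨j, rfl⟩ : ∃ j, k = j + 1 := ⟨k - 1, by omega⟩
    exact partialJet_succ_C j a

/-- The variational derivative of the `ε²`-coefficient of the `D`-operator. -/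
def eulerDop2 (c a : SmoothFun U) : DiffPoly U :=
  cf (cCoeff c a) * uxx + (1 / 2 : ℝ) • (cf (ddu (cCoeff c a)) * ux ^ 2)

/-- The variational derivative of the `ε⁴`-coefficient of the `D`-operator. -/
def eulerDop4 (c p s a : SmoothFun U) : DiffPoly U :=
  (2 : ℝ) • (cf (pCoeff c p a) * u4) + (4 : ℝ) • (cf (ddu (pCoeff c p a)) * (ux * u3))
    + (3 : ℝ) • (cf (ddu (pCoeff c p a)) * uxx ^ 2)
    + cf ((2 : ℝ) • ddu (ddu (pCoeff c p a)) - (12 : ℝ) • sCoeff c p s a) * (ux ^ 2 * uxx)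
    - (3 : ℝ) • (cf (ddu (sCoeff c p s a)) * ux ^ 4)

theorem euler_dop2 (c a : SmoothFun U) : euler (dop2 c a) = eulerDop2 c a := by
  obtain ⟨h0, h1, h2⟩ := partialJet_dop2 c a
  rw [euler_of_order_two _ (fun k hk => h2 k (by omega)), h0, h1, h2 2 le_rfl]
  apply DiffPoly.ext_eval
  intro v ρ
  simp only [eulerDop2, map_neg, map_zero, map_add, map_sub, totalD_mul, totalD_C, totalD_jet,
    evalJet_smul, map_mul, map_pow, evalJet_C, evalJet_X]
  ring

theorem euler_dop4 (c p s a : SmoothFun U) : euler (dop4 c p s a) = eulerDop4 c p s a := by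
  obtain ⟨h0, h1, h2, h3⟩ := partialJet_dop4 c p s a
  rw [euler_of_order_two _ h3, h0, h1, h2]
  apply DiffPoly.ext_eval
  intro v ρ
  simp only [eulerDop4, totalD_smul, map_add, map_sub, totalD_mul, totalD_pow, totalD_C,
    totalD_jet, evalJet_smul, map_mul, map_pow, evalJet_C, evalJet_X, SmoothFun.smul_apply]
  norm_num
  ring

theorem euler_C_mul_ux_cubed (a : SmoothFun U) :
    euler (cf a * ux ^ 3) =
      -((2 : ℝ) • (cf (ddu a) * ux ^ 3)) - (6 : ℝ) • (cf a * (ux * uxx)) := by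
  obtain ⟨h0, h1, h2⟩ := partialJet_C_mul_ux_pow a 3
  rw [euler_of_order_two _ (fun k hk => h2 k (by omega)), h0, h1, h2 2 le_rfl]
  apply DiffPoly.ext_eval
  intro v ρ
  simp only [map_zero, map_add, map_sub, map_neg, totalD_smul, totalD_mul, totalD_pow, totalD_C,
    totalD_jet, evalJet_smul, map_mul, map_pow, evalJet_C, evalJet_X]
  norm_num
  ring

theorem euler_x_mul_C (a : SmoothFun U) : euler (xv * cf a) = xv * cf (ddu a) := by
  have h : ∀ k, 1 ≤ k → partialJet k (cf a) = 0 := by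
    intro k hk
    obtain ⟨j, rfl⟩ : ∃ j, k = j + 1 := ⟨k - 1, by omega⟩
    exact partialJet_succ_C j a
  rw [euler_x_mul_of_order_two _ (fun k hk => h k (by omega)), euler_C, h 1 le_rfl,
    h 2 (by omega), map_zero]
  ring

theorem euler_x_mul_dop2 (c a : SmoothFun U) :
    euler (xv * dop2 c a) = xv * eulerDop2 c a + cf (cCoeff c a) * ux := by
  obtain ⟨h0, h1, h2⟩ := partialJet_dop2 c a
  rw [euler_x_mul_of_order_two _ (fun k hk => h2 k (by omega)), euler_dop2, h1, h2 2 le_rfl,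
    map_zero]
  ring

/-- The part of the variational derivative of `x` times the `ε⁴`-coefficient of the `D`-operator
that is free of `x`. -/
def eulerXDop4 (c p s a : SmoothFun U) : DiffPoly U :=
  (4 : ℝ) • (cf (pCoeff c p a) * u3 + cf (ddu (pCoeff c p a)) * (ux * uxx)
    - cf (sCoeff c p s a) * ux ^ 3)

theorem euler_x_mul_dop4 (c p s a : SmoothFun U) :
    euler (xv * dop4 c p s a) = xv * eulerDop4 c p s a + eulerXDop4 c p s a := by
  obtain ⟨h0, h1, h2, h3⟩ := partialJet_dop4 c p s a
  rw [euler_x_mul_of_order_two _ h3, euler_dop4, h1, h2]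
  apply DiffPoly.ext_eval
  intro v ρ
  simp only [eulerXDop4, totalD_smul, map_add, map_sub, totalD_mul, totalD_C,
    totalD_jet, evalJet_smul, map_mul, map_pow, evalJet_C, evalJet_X, map_ofNat]
  ring

/-! ### Fluxes of the Hamiltonian flow -/

/-- The flux at order `ε²` of the density `D(f)` along the flow of `H_h`. -/
def flux2 (c f h : SmoothFun U) : DiffPoly U :=
  cf (c * dn 1 f * dn 3 h) * uxx
  + cf ((1/2 : ℝ) • (c * dn 1 f * dn 4 h) - (1/2 : ℝ) • (c * dn 2 f * dn 3 h)
        + (1/2 : ℝ) • (c * dn 3 f * dn 2 h) + (1/2 : ℝ) • (dn 1 c * dn 1 f * dn 3 h)) * ux ^ 2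

/-- The flux at order `ε⁴` of the density `D(f)` along the flow of `H_h`. -/
def flux4 (c p s f h : SmoothFun U) : DiffPoly U :=
  cf ((3/5 : ℝ) • (c ^ 2 * dn 1 f * dn 4 h) + (2 : ℝ) • (dn 1 f * dn 3 h * p)) * u4
  + cf ((12/5 : ℝ) • (c * dn 1 c * dn 1 f * dn 4 h) + (6/5 : ℝ) • (c ^ 2 * dn 1 f * dn 5 h)
        - (3/5 : ℝ) • (c ^ 2 * dn 2 f * dn 4 h) + (3/5 : ℝ) • (c ^ 2 * dn 4 f * dn 2 h)
        + (4 : ℝ) • (dn 1 f * dn 3 h * dn 1 p) + (4 : ℝ) • (dn 1 f * dn 4 h * p)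
        - (2 : ℝ) • (dn 2 f * dn 3 h * p) + (2 : ℝ) • (dn 3 f * dn 2 h * p)) * (ux * u3)
  + cf ((9/5 : ℝ) • (c * dn 1 c * dn 1 f * dn 4 h) + (9/10 : ℝ) • (c ^ 2 * dn 1 f * dn 5 h)
        + (3/10 : ℝ) • (c ^ 2 * dn 2 f * dn 4 h) + (1/2 : ℝ) • (c ^ 2 * dn 3 f * dn 3 h)
        - (3/10 : ℝ) • (c ^ 2 * dn 4 f * dn 2 h) + (3 : ℝ) • (dn 1 f * dn 3 h * dn 1 p)
        + (3 : ℝ) • (dn 1 f * dn 4 h * p) + dn 2 f * dn 3 h * p - dn 3 f * dn 2 h * p) * uxx ^ 2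
  + cf ((39/10 : ℝ) • (c * dn 1 c * dn 1 f * dn 5 h) - (6/5 : ℝ) • (c * dn 1 c * dn 2 f * dn 4 h)
        + (1/2 : ℝ) • (c * dn 1 c * dn 3 f * dn 3 h) + (6/5 : ℝ) • (c * dn 1 c * dn 4 f * dn 2 h)
        + (27/10 : ℝ) • (c * dn 2 c * dn 1 f * dn 4 h) + (11/10 : ℝ) • (c ^ 2 * dn 1 f * dn 6 h)
        - (3/5 : ℝ) • (c ^ 2 * dn 2 f * dn 5 h) + (3/5 : ℝ) • (c ^ 2 * dn 3 f * dn 4 h)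
        - (1/10 : ℝ) • (c ^ 2 * dn 4 f * dn 3 h) + (3/5 : ℝ) • (c ^ 2 * dn 5 f * dn 2 h)
        + (6/5 : ℝ) • (dn 1 c ^ 2 * dn 1 f * dn 4 h) + (2 : ℝ) • (dn 1 f * dn 3 h * dn 2 p)
        - (12 : ℝ) • (dn 1 f * dn 3 h * s) + (6 : ℝ) • (dn 1 f * dn 4 h * dn 1 p)
        + (4 : ℝ) • (dn 1 f * dn 5 h * p) - (2 : ℝ) • (dn 2 f * dn 3 h * dn 1 p)
        - (2 : ℝ) • (dn 2 f * dn 4 h * p) + (2 : ℝ) • (dn 3 f * dn 2 h * dn 1 p)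
        + (2 : ℝ) • (dn 4 f * dn 2 h * p)) * (ux ^ 2 * uxx)
  + cf ((5/8 : ℝ) • (c * dn 1 c * dn 1 f * dn 6 h) - (3/8 : ℝ) • (c * dn 1 c * dn 2 f * dn 5 h)
        + (3/8 : ℝ) • (c * dn 1 c * dn 3 f * dn 4 h) - (1/8 : ℝ) • (c * dn 1 c * dn 4 f * dn 3 h)
        + (3/8 : ℝ) • (c * dn 1 c * dn 5 f * dn 2 h) + (3/4 : ℝ) • (c * dn 2 c * dn 1 f * dn 5 h)
        - (3/8 : ℝ) • (c * dn 2 c * dn 2 f * dn 4 h) + (3/8 : ℝ) • (c * dn 2 c * dn 4 f * dn 2 h)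
        + (3/8 : ℝ) • (c * dn 3 c * dn 1 f * dn 4 h) + (1/8 : ℝ) • (c ^ 2 * dn 1 f * dn 7 h)
        - (1/8 : ℝ) • (c ^ 2 * dn 2 f * dn 6 h) + (1/8 : ℝ) • (c ^ 2 * dn 3 f * dn 5 h)
        + (1/8 : ℝ) • (c ^ 2 * dn 4 f * dn 4 h) - (1/8 : ℝ) • (c ^ 2 * dn 5 f * dn 3 h)
        + (1/8 : ℝ) • (c ^ 2 * dn 6 f * dn 2 h) + (3/8 : ℝ) • (dn 1 c * dn 2 c * dn 1 f * dn 4 h)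
        + (3/8 : ℝ) • (dn 1 c ^ 2 * dn 1 f * dn 5 h) + (1/8 : ℝ) • (dn 1 c ^ 2 * dn 3 f * dn 3 h)
        - (3 : ℝ) • (dn 1 f * dn 3 h * dn 1 s) + (1/2 : ℝ) • (dn 1 f * dn 4 h * dn 2 p)
        - (3 : ℝ) • (dn 1 f * dn 4 h * s) + dn 1 f * dn 5 h * dn 1 p
        + (1/2 : ℝ) • (dn 1 f * dn 6 h * p) + (3 : ℝ) • (dn 2 f * dn 3 h * s)
        - (1/2 : ℝ) • (dn 2 f * dn 4 h * dn 1 p) - (1/2 : ℝ) • (dn 2 f * dn 5 h * p)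
        - (3 : ℝ) • (dn 3 f * dn 2 h * s) + (1/2 : ℝ) • (dn 3 f * dn 4 h * p)
        + (1/2 : ℝ) • (dn 4 f * dn 2 h * dn 1 p) - (1/2 : ℝ) • (dn 4 f * dn 3 h * p)
        + (1/2 : ℝ) • (dn 5 f * dn 2 h * p)) * ux ^ 4

/-- The right-hand side is the `ε²` coefficient of `E(D(f)) · d/dx E(D(h))`; exactness at this order
needs no condition on `c`. -/
theorem totalD_flux2 (c f h : SmoothFun U) :
    totalD (flux2 c f h) =
      cf (ddu f) * totalD (eulerDop2 c h) + eulerDop2 c f * totalD (cf (ddu h)) := by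
  apply DiffPoly.ext_eval
  intro v ρ
  simp only [flux2, eulerDop2, totalD_smul, map_add, map_sub, totalD_mul, totalD_pow, totalD_C,
    totalD_jet, evalJet_smul, map_mul, map_pow, evalJet_C, evalJet_X]
  simp only [cCoeff, dn_succ, dn_zero, ddu_add, ddu_smul, ddu_mul,
    SmoothFun.add_apply, SmoothFun.mul_apply, SmoothFun.smul_apply]
  norm_num
  ring

/-- Here the higher-derivative terms in `p_a` and `s_a` matter: they make the `ε⁴` coefficient exact
for arbitrary `c`, `p`, `s`. -/
theorem totalD_flux4 (c p s f h : SmoothFun U) :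
    totalD (flux4 c p s f h) =
      cf (ddu f) * totalD (eulerDop4 c p s h) + eulerDop2 c f * totalD (eulerDop2 c h)
        + eulerDop4 c p s f * totalD (cf (ddu h)) := by
  apply DiffPoly.ext_eval
  intro v ρ
  simp only [flux4, eulerDop2, eulerDop4, totalD_smul, map_add, map_sub, totalD_mul, totalD_pow,
    totalD_C, totalD_jet, evalJet_smul, map_mul, map_pow, evalJet_C, evalJet_X]
  simp only [cCoeff, pCoeff, sCoeff, dn_succ, dn_zero, ddu_add, ddu_sub, ddu_smul, ddu_mul,
    ddu_pow, SmoothFun.add_apply, SmoothFun.sub_apply, SmoothFun.mul_apply, SmoothFun.smul_apply,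
    SmoothFun.pow_apply]
  norm_num
  ring

/-! ### The Galilean part of the special functional -/

/-- The term of order `ε⁴` in the flux of `x D(r) + t D(q) + ε⁴ e u_x³`, up to terms coming from
`D(r)` and `D(q)`. -/
def fluxX4 (c s h : SmoothFun U) (lam : ℝ) : DiffPoly U :=
  cf (-((2 : ℝ) • (lam • (c ^ 2 * dn 3 h))) - (3/5 : ℝ) • (c * dn 4 h)
        - (6/5 : ℝ) • (dn 1 c * dn 3 h)) * u3
  + cf (-((10 : ℝ) • (lam • (c * dn 1 c * dn 3 h))) - (2 : ℝ) • (lam • (c * dn 2 c * dn 2 h))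
        - (2 : ℝ) • (lam • (c ^ 2 * dn 4 h)) + (4 : ℝ) • (lam • (dn 1 c ^ 2 * dn 2 h))
        - (3/5 : ℝ) • (c * dn 5 h) + (12/5 : ℝ) • (dn 1 c * dn 2 c * dn 2 h * c⁻¹ʳ)
        - (18/5 : ℝ) • (dn 1 c * dn 4 h) - (8/5 : ℝ) • (dn 1 c ^ 2 * dn 3 h * c⁻¹ʳ)
        - (6/5 : ℝ) • (dn 1 c ^ 3 * dn 2 h * c⁻¹ʳ ^ 2) - (11/5 : ℝ) • (dn 2 c * dn 3 h)
        - (3/5 : ℝ) • (dn 3 c * dn 2 h)) * (ux * uxx)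
  + cf (-((2 : ℝ) • (lam • (c * dn 1 c * dn 4 h))) + (2 : ℝ) • (lam • (c * dn 2 c * dn 3 h))
        - (11/6 : ℝ) • (lam • (c * dn 3 c * dn 2 h)) - (2/3 : ℝ) • (lam • (c ^ 2 * dn 5 h))
        + (13/2 : ℝ) • (lam • (dn 1 c * dn 2 c * dn 2 h))
        - (4 : ℝ) • (lam • (dn 1 c ^ 2 * dn 3 h))
        - (2 : ℝ) • (lam • (dn 1 c ^ 3 * dn 2 h * c⁻¹ʳ)) - (1/6 : ℝ) • (c * dn 6 h)
        - (49/30 : ℝ) • (dn 1 c * dn 2 c * dn 3 h * c⁻¹ʳ)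
        + (173/120 : ℝ) • (dn 1 c * dn 3 c * dn 2 h * c⁻¹ʳ)
        + (5 : ℝ) • (dn 1 c * dn 2 h * s * c⁻¹ʳ ^ 2) - (9/10 : ℝ) • (dn 1 c * dn 5 h)
        - (53/24 : ℝ) • (dn 1 c ^ 2 * dn 2 c * dn 2 h * c⁻¹ʳ ^ 2)
        - (14/15 : ℝ) • (dn 1 c ^ 2 * dn 4 h * c⁻¹ʳ)
        + (4/15 : ℝ) • (dn 1 c ^ 3 * dn 3 h * c⁻¹ʳ ^ 2)
        + (8/15 : ℝ) • (dn 1 c ^ 4 * dn 2 h * c⁻¹ʳ ^ 3) - (19/30 : ℝ) • (dn 2 c * dn 4 h)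
        + (157/120 : ℝ) • (dn 2 c ^ 2 * dn 2 h * c⁻¹ʳ) + (1/2 : ℝ) • (dn 3 c * dn 3 h)
        - (5/12 : ℝ) • (dn 4 c * dn 2 h) - dn 2 h * dn 1 s * c⁻¹ʳ
        + (4 : ℝ) • (dn 3 h * s * c⁻¹ʳ)) * ux ^ 3

/-- Closed forms let the long computations below treat the reciprocal as an opaque function, instead
of expanding its derivatives inside much larger expressions. -/
theorem dn_inverse (c : SmoothFun U) (hc : ∀ v : U, c v ≠ 0) :
    dn 1 c⁻¹ʳ = -(dn 1 c * c⁻¹ʳ ^ 2) ∧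
    dn 2 c⁻¹ʳ = (2 : ℝ) • (dn 1 c ^ 2 * c⁻¹ʳ ^ 3) - dn 2 c * c⁻¹ʳ ^ 2 ∧
    dn 3 c⁻¹ʳ = (6 : ℝ) • (dn 1 c * dn 2 c * c⁻¹ʳ ^ 3) - (6 : ℝ) • (dn 1 c ^ 3 * c⁻¹ʳ ^ 4)
      - dn 3 c * c⁻¹ʳ ^ 2 ∧
    dn 4 c⁻¹ʳ = (8 : ℝ) • (dn 1 c * dn 3 c * c⁻¹ʳ ^ 3)
      - (36 : ℝ) • (dn 1 c ^ 2 * dn 2 c * c⁻¹ʳ ^ 4) + (24 : ℝ) • (dn 1 c ^ 4 * c⁻¹ʳ ^ 5)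
      + (6 : ℝ) • (dn 2 c ^ 2 * c⁻¹ʳ ^ 3) - dn 4 c * c⁻¹ʳ ^ 2 ∧
    dn 5 c⁻¹ʳ = -((90 : ℝ) • (dn 1 c * dn 2 c ^ 2 * c⁻¹ʳ ^ 4))
      + (10 : ℝ) • (dn 1 c * dn 4 c * c⁻¹ʳ ^ 3) - (60 : ℝ) • (dn 1 c ^ 2 * dn 3 c * c⁻¹ʳ ^ 4)
      + (240 : ℝ) • (dn 1 c ^ 3 * dn 2 c * c⁻¹ʳ ^ 5) - (120 : ℝ) • (dn 1 c ^ 5 * c⁻¹ʳ ^ 6)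
      + (20 : ℝ) • (dn 2 c * dn 3 c * c⁻¹ʳ ^ 3) - dn 5 c * c⁻¹ʳ ^ 2 := by
  have h1 := ddu_inverse c hc
  have h (n : ℕ) : dn (n + 1) c⁻¹ʳ = ddu (dn n c⁻¹ʳ) := dn_succ n _
  -- The only property of the reciprocal used from here on is `y' = -c' y²`; each formula follows by
  -- differentiating the previous one.
  generalize c⁻¹ʳ = y at *
  have e1 : dn 1 y = -(dn 1 c * y ^ 2) := h1
  have e2 : dn 2 y = (2 : ℝ) • (dn 1 c ^ 2 * y ^ 3) - dn 2 c * y ^ 2 := by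
    rw [h, e1]
    ext v
    simp only [dn_succ, dn_zero, h1, ddu_add, ddu_sub, ddu_smul, ddu_mul, ddu_pow, ddu_neg,
      SmoothFun.add_apply, SmoothFun.sub_apply, SmoothFun.mul_apply, SmoothFun.smul_apply,
      SmoothFun.neg_apply, SmoothFun.pow_apply]
    norm_num
    ring
  have e3 : dn 3 y = (6 : ℝ) • (dn 1 c * dn 2 c * y ^ 3) - (6 : ℝ) • (dn 1 c ^ 3 * y ^ 4)
        - dn 3 c * y ^ 2 := by
    rw [h, e2]
    ext v
    simp only [dn_succ, dn_zero, h1, ddu_add, ddu_sub, ddu_smul, ddu_mul, ddu_pow, ddu_neg,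
      SmoothFun.add_apply, SmoothFun.sub_apply, SmoothFun.mul_apply, SmoothFun.smul_apply,
      SmoothFun.neg_apply, SmoothFun.pow_apply]
    norm_num
    ring
  have e4 : dn 4 y = (8 : ℝ) • (dn 1 c * dn 3 c * y ^ 3) - (36 : ℝ) • (dn 1 c ^ 2 * dn 2 c * y ^ 4)
        + (24 : ℝ) • (dn 1 c ^ 4 * y ^ 5) + (6 : ℝ) • (dn 2 c ^ 2 * y ^ 3)
        - dn 4 c * y ^ 2 := by
    rw [h, e3]
    ext v
    simp only [dn_succ, dn_zero, h1, ddu_add, ddu_sub, ddu_smul, ddu_mul, ddu_pow, ddu_neg,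
      SmoothFun.add_apply, SmoothFun.sub_apply, SmoothFun.mul_apply, SmoothFun.smul_apply,
      SmoothFun.neg_apply, SmoothFun.pow_apply]
    norm_num
    ring
  have e5 : dn 5 y = -((90 : ℝ) • (dn 1 c * dn 2 c ^ 2 * y ^ 4)) + (10 : ℝ) • (dn 1 c * dn 4 c * y ^ 3)
        - (60 : ℝ) • (dn 1 c ^ 2 * dn 3 c * y ^ 4)
        + (240 : ℝ) • (dn 1 c ^ 3 * dn 2 c * y ^ 5) - (120 : ℝ) • (dn 1 c ^ 5 * y ^ 6)
        + (20 : ℝ) • (dn 2 c * dn 3 c * y ^ 3) - dn 5 c * y ^ 2 := by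
    rw [h, e4]
    ext v
    simp only [dn_succ, dn_zero, h1, ddu_add, ddu_sub, ddu_smul, ddu_mul, ddu_pow, ddu_neg,
      SmoothFun.add_apply, SmoothFun.sub_apply, SmoothFun.mul_apply, SmoothFun.smul_apply,
      SmoothFun.neg_apply, SmoothFun.pow_apply]
    norm_num
    ring
  exact ⟨e1, e2, e3, e4, e5⟩

/-- The `ε²` part of the statement that the `x`-free leftover of `x D(r)` equals `-D(q)` up to a
total derivative. -/
theorem totalD_fluxX2 (c r q h : SmoothFun U) (hc : ∀ v : U, c v ≠ 0)
    (hr : ddu r = c⁻¹ʳ) (hq : ddu q = dn 2 h * c⁻¹ʳ) :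
    totalD (-(cf (dn 3 h) * ux)) =
      dop2 c q - flux2 c r h + cf (cCoeff c r) * ux * totalD (cf (ddu h)) := by
  apply DiffPoly.ext_eval
  intro v ρ
  simp only [flux2, dop2, map_add, map_sub, map_neg, totalD_mul, totalD_C,
    totalD_jet, evalJet_smul, map_mul, map_pow, evalJet_C, evalJet_X]
  simp only [cCoeff, dn_succ, dn_zero, hr, hq, ddu_inverse c hc, ddu_add, ddu_mul, ddu_pow, ddu_neg,
    SmoothFun.add_apply, SmoothFun.mul_apply,
    SmoothFun.smul_apply, SmoothFun.neg_apply, SmoothFun.pow_apply, (c.inverse_apply hc).2]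
  have := hc v
  norm_num
  field_simp
  ring

-- The `ε⁴` counterpart, and the one place in the conservation argument where the form of `p` and
-- the function `e` are used. The last summand collects the `x`-free terms contributed by `x D(r)`
-- and by `e u_x³`.
set_option maxHeartbeats 1000000 in
theorem totalD_fluxX4 (c p s r q h : SmoothFun U) (lam : ℝ) (hc : ∀ v : U, c v ≠ 0)
    (hp : p = (3 / 5 : ℝ) • (c * ddu c) + lam • c ^ 3)
    (hr : ddu r = c⁻¹ʳ) (hq : ddu q = dn 2 h * c⁻¹ʳ) :
    totalD (fluxX4 c s h lam) =
      dop4 c p s q - flux4 c p s r h + cf (cCoeff c r) * ux * totalD (eulerDop2 c h)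
        + (eulerXDop4 c p s r + euler (cf (gaugeE c s lam) * ux ^ 3)) * totalD (cf (ddu h)) := by
  rw [euler_C_mul_ux_cubed]
  apply DiffPoly.ext_eval
  intro v ρ
  obtain ⟨h1, h2, h3, h4, h5⟩ := dn_inverse c hc
  have hv := hc v
  have h0 := (c.inverse_apply hc).2 v
  replace h1 := congrArg (fun a : SmoothFun U => a v) h1
  replace h2 := congrArg (fun a : SmoothFun U => a v) h2
  replace h3 := congrArg (fun a : SmoothFun U => a v) h3
  replace h4 := congrArg (fun a : SmoothFun U => a v) h4
  replace h5 := congrArg (fun a : SmoothFun U => a v) h5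
  simp only [gaugeE, fluxX4]
  -- With the reciprocal opaque, its derivatives at `v` stay atoms until the pointwise formulas
  -- `h1`–`h5` replace them by derivatives of `c` and powers of `1 / c v`.
  generalize c⁻¹ʳ = y at *
  simp only [flux4, dop4, eulerDop2, eulerXDop4, totalD_smul, map_add, map_sub, map_neg,
    totalD_mul, totalD_pow, totalD_C, totalD_jet, evalJet_smul, map_mul, map_pow, evalJet_C,
    evalJet_X]
  simp only [cCoeff, pCoeff, sCoeff, dn_succ, dn_zero, hp, hr, hq,
    ddu_add, ddu_sub, ddu_smul, ddu_mul, ddu_pow, ddu_neg, SmoothFun.add_apply,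
    SmoothFun.sub_apply, SmoothFun.mul_apply, SmoothFun.smul_apply, SmoothFun.neg_apply,
    SmoothFun.pow_apply, Nat.reduceSub, Nat.cast_ofNat, pow_one] at h1 h2 h3 h4 h5 ⊢
  simp only [h5, h4, h3, h2, h1, h0]
  field_simp
  ring

/-! ### Conservation of the special functionals -/

theorem euler_dop (c p s a : SmoothFun U) :
    euler (dop c p s a) = cf (ddu a) + eps ^ 2 * eulerDop2 c a + eps ^ 4 * eulerDop4 c p s a := by
  rw [dop, euler_add, euler_add, euler_eps_pow_mul, euler_eps_pow_mul, euler_C, euler_dop2,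
    euler_dop4]

theorem euler_x_mul_dop (c p s a : SmoothFun U) :
    euler (xv * dop c p s a) =
      xv * euler (dop c p s a) + eps ^ 2 * (cf (cCoeff c a) * ux) +
        eps ^ 4 * eulerXDop4 c p s a := by
  have : xv * dop c p s a =
      xv * cf a + eps ^ 2 * (xv * dop2 c a) + eps ^ 4 * (xv * dop4 c p s a) := by
    rw [dop]
    ring
  rw [this, euler_add, euler_add, euler_eps_pow_mul, euler_eps_pow_mul, euler_x_mul_C,
    euler_x_mul_dop2, euler_x_mul_dop4, euler_dop]
  ring

theorem euler_dopTrunc (c p s f f₁ f₂ : SmoothFun U) :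
    euler (dopTrunc c p s f f₁ f₂) =
      cf (ddu f) + eps ^ 2 * (cf (ddu f₁) + eulerDop2 c f) +
        eps ^ 4 * (cf (ddu f₂) + eulerDop2 c f₁ + eulerDop4 c p s f) := by
  simp only [dopTrunc, euler_add, euler_eps_pow_mul, euler_C, euler_dop2, euler_dop4]

theorem euler_densityS (c p s r q f f₁ f₂ : SmoothFun U) (lam : ℝ) :
    euler (densityS c p s r q f f₁ f₂ lam) =
      xv * euler (dop c p s r) + tv * euler (dop c p s q) + eps ^ 2 * (cf (cCoeff c r) * ux)
        + eps ^ 4 * (eulerXDop4 c p s r + euler (cf (gaugeE c s lam) * ux ^ 3))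
        - euler (dopTrunc c p s f f₁ f₂) := by
  rw [densityS, densityS0, euler_sub, euler_add, euler_add, euler_x_mul_dop, euler_t_mul,
    euler_eps_pow_mul]
  ring

/-- The densities `D(a)` are conserved along the flow of `H_h` up to order `ε⁶`. -/
theorem euler_dop_mul_totalD (c p s a h : SmoothFun U) :
    ∃ R, euler (dop c p s a) * totalD (euler (dop c p s h)) =
      cf (ddu a * dn 2 h) * ux + totalD (eps ^ 2 * flux2 c a h + eps ^ 4 * flux4 c p s a h)
        + eps ^ 6 * R := by
  -- The witness consists of the cross terms of order `ε⁶` and `ε⁸` in the product of the two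
  -- expansions.
  refine ⟨eulerDop2 c a * totalD (eulerDop4 c p s h)
    + eulerDop4 c p s a * totalD (eulerDop2 c h)
    + eps ^ 2 * (eulerDop4 c p s a * totalD (eulerDop4 c p s h)), ?_⟩
  have h0 : cf (ddu a * dn 2 h) * ux = cf (ddu a) * totalD (cf (ddu h)) := by
    rw [totalD_C, ← mul_assoc, ← map_mul]
    rfl
  rw [h0]
  simp only [euler_dop, map_add, totalD_mul, totalD_eps_pow, totalD_flux2, totalD_flux4, zero_mul,
    zero_add]
  ring

/-- Such a density is the total derivative of a primitive of `a`; the direct computation avoids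
constructing a primitive on `U`. -/
theorem euler_C_mul_ux (a : SmoothFun U) : euler (cf a * ux) = 0 := by
  obtain ⟨h0, h1, h2⟩ := partialJet_C_mul_ux_pow a 1
  rw [pow_one] at h0 h1 h2
  rw [euler_of_order_two _ (fun k hk => h2 k (by omega)), h0, h1, h2 2 le_rfl]
  simp [totalD_C]

theorem partialT_euler_densityS (c p s r q f f₁ f₂ : SmoothFun U) (lam : ℝ) :
    partialT (euler (densityS c p s r q f f₁ f₂ lam)) = euler (dop c p s q) := by
  classical
  have hsmul (y : ℝ) (L : DiffPoly U) :
      MvPolynomial.pderiv JetVar.t (y • L) = y • MvPolynomial.pderiv JetVar.t L :=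
    ((MvPolynomial.pderiv JetVar.t).restrictScalars ℝ).map_smul y L
  rw [euler_densityS, euler_dopTrunc, euler_C_mul_ux_cubed]
  simp only [partialT, euler_dop, eulerDop2, eulerDop4, eulerXDop4]
  simp [hsmul, MvPolynomial.pderiv_X]

theorem totalD_eps_pow_mul (n : ℕ) (L : DiffPoly U) :
    totalD (eps ^ n * L) = eps ^ n * totalD L := by
  rw [totalD_mul, totalD_eps_pow, zero_mul, zero_add]

theorem totalD_x_mul (L : DiffPoly U) : totalD (xv * L) = L + xv * totalD L := by
  rw [totalD_mul, totalD_x, one_mul]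

theorem totalD_t_mul (L : DiffPoly U) : totalD (tv * L) = tv * totalD L := by
  rw [totalD_mul, totalD_t, zero_mul, zero_add]

/-- The functional `S_f` is conserved up to order `ε⁶`. -/
theorem densityS_conserved (h c p s r q f f₁ f₂ : SmoothFun U) (lam : ℝ)
    (hc : ∀ v : U, c v ≠ 0) (hp : p = (3 / 5 : ℝ) • (c * ddu c) + lam • c ^ 3)
    (hr : ddu r = c⁻¹ʳ) (hq : ddu q = dn 2 h * c⁻¹ʳ) :
    ∃ R : DiffPoly U,
      partialT (euler (densityS c p s r q f f₁ f₂ lam))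
        + euler (euler (densityS c p s r q f f₁ f₂ lam) * totalD (euler (dop c p s h)))
        = eps ^ 6 * R := by
  have hx2 := totalD_fluxX2 c r q h hc hr hq
  have hx4 := totalD_fluxX4 c p s r q h lam hc hp hr hq
  obtain ⟨Rr, hbr⟩ := euler_dop_mul_totalD c p s r h
  obtain ⟨Rq, hbq⟩ := euler_dop_mul_totalD c p s q h
  obtain ⟨Rf, hbf⟩ := euler_dop_mul_totalD c p s f h
  obtain ⟨Rf₁, hbf₁⟩ := euler_dop_mul_totalD c p s f₁ h
  obtain ⟨Rf₂, hbf₂⟩ := euler_dop_mul_totalD c p s f₂ h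
  -- The leading flux of `D(r)` thus has the primitive `q`, which is needed explicitly because this
  -- term is multiplied by `x`.
  have hq0 : totalD (cf q) = cf (ddu r * dn 2 h) * ux := by
    rw [totalD_C, hq, hr, mul_comm (dn 2 h)]
  have hdq : dop c p s q = cf q + eps ^ 2 * dop2 c q + eps ^ 4 * dop4 c p s q := rfl
  have htr := congrArg euler (dopTrunc_spec c p s f f₁ f₂)
  simp only [euler_add, euler_eps_pow_mul] at htr
  have hB : totalD (euler (dop c p s h)) = totalD (cf (ddu h)) + eps ^ 2 * totalD (eulerDop2 c h)
      + eps ^ 4 * totalD (eulerDop4 c p s h) := by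
    simp only [euler_dop, map_add, totalD_mul, totalD_eps_pow, zero_mul, zero_add]
  obtain ⟨R, hR⟩ : ∃ R, euler (densityS c p s r q f f₁ f₂ lam) * totalD (euler (dop c p s h)) =
      -dop c p s q
      + totalD (xv * (cf q + (eps ^ 2 * flux2 c r h + eps ^ 4 * flux4 c p s r h))
        + eps ^ 2 * (-(cf (dn 3 h) * ux)) + eps ^ 4 * fluxX4 c s h lam
        + tv * (eps ^ 2 * flux2 c q h + eps ^ 4 * flux4 c p s q h)
        - (eps ^ 2 * flux2 c f h + eps ^ 4 * flux4 c p s f h)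
        - eps ^ 2 * (eps ^ 2 * flux2 c f₁ h + eps ^ 4 * flux4 c p s f₁ h)
        - eps ^ 4 * (eps ^ 2 * flux2 c f₂ h + eps ^ 4 * flux4 c p s f₂ h))
      + tv * (cf (ddu q * dn 2 h) * ux) - cf (ddu f * dn 2 h) * ux
      - eps ^ 2 * (cf (ddu f₁ * dn 2 h) * ux) - eps ^ 4 * (cf (ddu f₂ * dn 2 h) * ux)
      + eps ^ 6 * R := by
    -- The common factor is kept as an atom in the flux identities; its expansion `hB` is needed
    -- only against the `x`-free corrections.
    generalize totalD (euler (dop c p s h)) = B at *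
    simp only [map_add, map_sub, totalD_x_mul, totalD_t_mul, totalD_eps_pow_mul]
      at hbr hbq hbf hbf₁ hbf₂ ⊢
    rw [euler_densityS]
    -- The remainder gathers those of the five flux identities, the products of the `x`-free
    -- corrections with higher orders of `B`, and `B` times the part removed by truncation.
    refine ⟨xv * Rr + tv * Rq - Rf - eps ^ 2 * Rf₁ - eps ^ 4 * Rf₂
      + cf (cCoeff c r) * ux * totalD (eulerDop4 c p s h)
      + (eulerXDop4 c p s r + euler (cf (gaugeE c s lam) * ux ^ 3))
        * (totalD (eulerDop2 c h) + eps ^ 2 * totalD (eulerDop4 c p s h))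
      + (euler (dop4 c p s f₁) + euler (dop2 c f₂) + eps ^ 2 * euler (dop4 c p s f₂)) * B, ?_⟩
    linear_combination xv * hbr + tv * hbq - hbf - eps ^ 2 * hbf₁ - eps ^ 4 * hbf₂ + B * htr + hdq
      - eps ^ 2 * hx2 - eps ^ 4 * hx4 - xv * hq0
      + (eps ^ 2 * (cf (cCoeff c r) * ux)
        + eps ^ 4 * (eulerXDop4 c p s r + euler (cf (gaugeE c s lam) * ux ^ 3))) * hB
  refine ⟨euler R, ?_⟩
  rw [partialT_euler_densityS, hR]
  simp only [euler_add, euler_sub, euler_neg, euler_totalD, euler_t_mul, euler_C_mul_ux,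
    euler_eps_pow_mul, mul_zero]
  ring

/-! ### The stationary solution at `t = 0` -/

theorem ddu_eq_mul_inverse (c f : SmoothFun U) (hc : ∀ v : U, c v ≠ 0) :
    ddu f = c * ddu f * c⁻¹ʳ := by
  have : c * c⁻¹ʳ = 1 := Ring.mul_inverse_cancel c (c.inverse_apply hc).1
  linear_combination -ddu f * this

theorem recip_apply_ne_zero (c f : SmoothFun U) (hw : ∀ v : U, ddu (c * ddu f) v ≠ 0) (v : U) :
    recip c f v ≠ 0 := by
  rw [recip, (SmoothFun.inverse_apply _ hw).2]
  exact inv_ne_zero (hw v)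

/-- With `X = c f'` this reads `X' = 1/w`. Together with `f' = X / c` it lets all derivatives of `f`
be eliminated in favour of `X`, `w` and `c`. -/
theorem inverse_recip (c f : SmoothFun U) (hw : ∀ v : U, ddu (c * ddu f) v ≠ 0) :
    (recip c f)⁻¹ʳ = ddu (c * ddu f) := by
  ext v
  rw [(SmoothFun.inverse_apply _ (recip_apply_ne_zero c f hw)).2, recip,
    (SmoothFun.inverse_apply _ hw).2, inv_inv]

/-- In terms of `w = 1 / (c f')'` the function `f̂₂` does not involve the derivatives of `f`. -/
theorem fHat₂_eq (c p s f : SmoothFun U) (lam : ℝ) (hc : ∀ v : U, c v ≠ 0)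
    (hw : ∀ v : U, ddu (c * ddu f) v ≠ 0)
    (hp : p = (3 / 5 : ℝ) • (c * ddu c) + lam • c ^ 3) :
    fHat₂ c p s f = (3/2 : ℝ) • (lam • (c ^ 2 * dn 1 c * recip c f ^ 2 * dn 1 (recip c f)))
        + (1/2 : ℝ) • (lam • (c ^ 3 * recip c f ^ 2 * dn 2 (recip c f)))
        - (3/20 : ℝ) • (c * dn 1 c * recip c f * dn 1 (recip c f) ^ 2)
        - (3/40 : ℝ) • (c * dn 1 c * recip c f ^ 2 * dn 2 (recip c f))
        - (3/40 : ℝ) • (c * dn 2 c * recip c f ^ 2 * dn 1 (recip c f))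
        - (1/12 : ℝ) • (c * dn 3 c * recip c f ^ 3)
        - (3/20 : ℝ) • (c ^ 2 * recip c f * dn 1 (recip c f) * dn 2 (recip c f))
        - (1/8 : ℝ) • (c ^ 2 * recip c f ^ 2 * dn 3 (recip c f))
        + (1/20 : ℝ) • (c ^ 2 * dn 1 (recip c f) ^ 3)
        + (3/10 : ℝ) • (dn 1 c ^ 2 * recip c f ^ 2 * dn 1 (recip c f)) - s * recip c f ^ 3 := by
  have hf := ddu_eq_mul_inverse c f hc
  have hX := inverse_recip c f hw
  ext v
  obtain ⟨h1, h2, h3, h4, -⟩ := dn_inverse c hc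
  obtain ⟨g1, g2, g3, -, -⟩ := dn_inverse (recip c f) (recip_apply_ne_zero c f hw)
  have hv := hc v
  have hwv := recip_apply_ne_zero c f hw v
  have h0 := (c.inverse_apply hc).2 v
  have g0 := ((recip c f).inverse_apply (recip_apply_ne_zero c f hw)).2 v
  simp only [fHat₂]
  generalize recip c f = w at *
  -- Derivatives of `X` are rewritten below as derivatives of `1/w`; the undifferentiated `X`
  -- cancels.
  generalize c * ddu f = X at *
  replace h1 := congrArg (fun a : SmoothFun U => a v) h1
  replace h2 := congrArg (fun a : SmoothFun U => a v) h2
  replace h3 := congrArg (fun a : SmoothFun U => a v) h3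
  replace h4 := congrArg (fun a : SmoothFun U => a v) h4
  replace g1 := congrArg (fun a : SmoothFun U => a v) g1
  replace g2 := congrArg (fun a : SmoothFun U => a v) g2
  replace g3 := congrArg (fun a : SmoothFun U => a v) g3
  generalize c⁻¹ʳ = y at *
  generalize w⁻¹ʳ = z at *
  simp only [dn_succ, dn_zero, hp, hf, ← hX,
    ddu_add, ddu_sub, ddu_smul, ddu_mul, ddu_pow, ddu_neg, SmoothFun.add_apply,
    SmoothFun.sub_apply, SmoothFun.mul_apply, SmoothFun.smul_apply, SmoothFun.neg_apply,
    SmoothFun.pow_apply, Nat.reduceSub, Nat.cast_ofNat, pow_one] at h1 h2 h3 h4 g1 g2 g3 ⊢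
  simp only [h4, h3, h2, h1, h0, g3, g2, g1, g0]
  field_simp
  ring

/-- The order `ε²` of the stationarity condition. -/
theorem stationary_eps_two (c r f f₁ : SmoothFun U) (hc : ∀ v : U, c v ≠ 0)
    (hw : ∀ v : U, ddu (c * ddu f) v ≠ 0) (hr : ddu r = c⁻¹ʳ)
    (hf₁ : ddu f₁ = (1 / 2 : ℝ) • (c⁻¹ʳ * dn 2 (c * recip c f)))
    (v : U) (ρ : JetVar → ℝ) (hρ0 : ρ (JetVar.jet 0) = recip c f v)
    (hρ1 : ρ (JetVar.jet 1) = (recip c f * ddu (recip c f)) v) :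
    (c * ddu f) v * evalJet v ρ (eulerDop2 c r) + evalJet v ρ (cf (cCoeff c r) * ux) =
      ddu f₁ v + evalJet v ρ (eulerDop2 c f) := by
  have hf := ddu_eq_mul_inverse c f hc
  have hX := inverse_recip c f hw
  obtain ⟨h1, h2, h3, -, -⟩ := dn_inverse c hc
  obtain ⟨g1, g2, -, -, -⟩ := dn_inverse (recip c f) (recip_apply_ne_zero c f hw)
  have hv := hc v
  have hwv := recip_apply_ne_zero c f hw v
  have h0 := (c.inverse_apply hc).2 v
  have g0 := ((recip c f).inverse_apply (recip_apply_ne_zero c f hw)).2 v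
  rw [hf₁]
  generalize recip c f = w at *
  generalize c * ddu f = X at *
  replace h1 := congrArg (fun a : SmoothFun U => a v) h1
  replace h2 := congrArg (fun a : SmoothFun U => a v) h2
  replace h3 := congrArg (fun a : SmoothFun U => a v) h3
  replace g1 := congrArg (fun a : SmoothFun U => a v) g1
  replace g2 := congrArg (fun a : SmoothFun U => a v) g2
  generalize c⁻¹ʳ = y at *
  generalize w⁻¹ʳ = z at *
  simp only [eulerDop2, map_add, map_mul, map_pow, evalJet_C, evalJet_X, evalJet_smul, cCoeff,
    dn_succ, dn_zero, hr, hf, ← hX, hρ0, hρ1,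
    ddu_add, ddu_sub, ddu_smul, ddu_mul, ddu_pow, ddu_neg, SmoothFun.add_apply,
    SmoothFun.sub_apply, SmoothFun.mul_apply, SmoothFun.smul_apply, SmoothFun.neg_apply,
    SmoothFun.pow_apply, Nat.reduceSub, Nat.cast_ofNat, pow_one] at h1 h2 h3 g1 g2 ⊢
  simp only [h3, h2, h1, h0, g2, g1, g0]
  field_simp
  ring

set_option maxHeartbeats 2000000 in
/-- The order `ε⁴` of the stationarity condition. -/
theorem stationary_eps_four (c p s r f f₁ f₂ : SmoothFun U) (lam : ℝ) (hc : ∀ v : U, c v ≠ 0)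
    (hw : ∀ v : U, ddu (c * ddu f) v ≠ 0)
    (hp : p = (3 / 5 : ℝ) • (c * ddu c) + lam • c ^ 3) (hr : ddu r = c⁻¹ʳ)
    (hf₁ : ddu f₁ = (1 / 2 : ℝ) • (c⁻¹ʳ * dn 2 (c * recip c f)))
    (hf₂ : ddu f₂ = c⁻¹ʳ * dn 2 (fHat₂ c p s f))
    (v : U) (ρ : JetVar → ℝ) (hρ0 : ρ (JetVar.jet 0) = recip c f v)
    (hρ1 : ρ (JetVar.jet 1) = (recip c f * ddu (recip c f)) v)
    (hρ2 : ρ (JetVar.jet 2) = (recip c f * ddu (recip c f * ddu (recip c f))) v)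
    (hρ3 : ρ (JetVar.jet 3) =
      (recip c f * ddu (recip c f * ddu (recip c f * ddu (recip c f)))) v) :
    (c * ddu f) v * evalJet v ρ (eulerDop4 c p s r) + evalJet v ρ (eulerXDop4 c p s r)
        + evalJet v ρ (euler (cf (gaugeE c s lam) * ux ^ 3)) =
      ddu f₂ v + evalJet v ρ (eulerDop2 c f₁) + evalJet v ρ (eulerDop4 c p s f) := by
  have hf := ddu_eq_mul_inverse c f hc
  have hX := inverse_recip c f hw
  obtain ⟨h1, h2, h3, h4, h5⟩ := dn_inverse c hc
  obtain ⟨g1, g2, g3, g4, g5⟩ := dn_inverse (recip c f) (recip_apply_ne_zero c f hw)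
  have hv := hc v
  have hwv := recip_apply_ne_zero c f hw v
  have h0 := (c.inverse_apply hc).2 v
  have g0 := ((recip c f).inverse_apply (recip_apply_ne_zero c f hw)).2 v
  -- Passing to the form in `w` before differentiating twice keeps the derivatives of `f` out of the
  -- expansion of `f₂'`.
  rw [hf₂, fHat₂_eq c p s f lam hc hw hp, euler_C_mul_ux_cubed]
  simp only [gaugeE]
  generalize recip c f = w at *
  generalize c * ddu f = X at *
  replace h1 := congrArg (fun a : SmoothFun U => a v) h1
  replace h2 := congrArg (fun a : SmoothFun U => a v) h2
  replace h3 := congrArg (fun a : SmoothFun U => a v) h3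
  replace h4 := congrArg (fun a : SmoothFun U => a v) h4
  replace h5 := congrArg (fun a : SmoothFun U => a v) h5
  replace g1 := congrArg (fun a : SmoothFun U => a v) g1
  replace g2 := congrArg (fun a : SmoothFun U => a v) g2
  replace g3 := congrArg (fun a : SmoothFun U => a v) g3
  replace g4 := congrArg (fun a : SmoothFun U => a v) g4
  replace g5 := congrArg (fun a : SmoothFun U => a v) g5
  generalize c⁻¹ʳ = y at *
  generalize w⁻¹ʳ = z at *
  simp only [eulerDop2, eulerDop4, eulerXDop4, map_add, map_sub, map_neg, map_mul, map_pow,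
    evalJet_C, evalJet_X, evalJet_smul]
  simp only [cCoeff, pCoeff, sCoeff,
    dn_succ, dn_zero, hp, hr, hf, hf₁, ← hX, hρ0, hρ1, hρ2, hρ3,
    ddu_add, ddu_sub, ddu_smul, ddu_mul, ddu_pow, ddu_neg, SmoothFun.add_apply,
    SmoothFun.sub_apply, SmoothFun.mul_apply, SmoothFun.smul_apply, SmoothFun.neg_apply,
    SmoothFun.pow_apply, Nat.reduceSub, Nat.cast_ofNat, pow_one]
    at h1 h2 h3 h4 h5 g1 g2 g3 g4 g5 ⊢
  simp only [h5, h4, h3, h2, h1, h0, g5, g4, g3, g2, g1, g0]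
  field_simp
  ring

/-! ### Derivatives of the solution `φ` as functions of `u`. -/

theorem SmoothFun.hasDerivAt_lift_comp (G : SmoothFun U) {φ : ℝ → ℝ} {x : ℝ} (hx : φ x ∈ U)
    (hφ : DifferentiableAt ℝ φ x) :
    HasDerivAt (fun y => G.lift (φ y)) (ddu G ⟨φ x, hx⟩ * deriv φ x) x := by
  have h := (G.lift_differentiableAt ⟨φ x, hx⟩).hasDerivAt
  rw [← ddu_apply G G.lift G.lift_apply] at h
  exact h.comp x hφ.hasDerivAt

/-- If the `n`-th derivative of `φ` is the function `G` of `φ` and `φ' = w(φ)`, then the next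
derivative of `φ` is `w G'` as a function of `φ`. -/
theorem iteratedDeriv_succ_eq {φ : ℝ → ℝ} {I : Set ℝ} (hI : IsOpen I)
    (hφ : ∀ x ∈ I, DifferentiableAt ℝ φ x) (hmaps : ∀ x ∈ I, φ x ∈ U) (w G : SmoothFun U)
    (hw : ∀ (x : ℝ) (hx : x ∈ I), deriv φ x = w ⟨φ x, hmaps x hx⟩) (n : ℕ)
    (hG : ∀ (x : ℝ) (hx : x ∈ I), iteratedDeriv n φ x = G ⟨φ x, hmaps x hx⟩)
    (x : ℝ) (hx : x ∈ I) :
    iteratedDeriv (n + 1) φ x = (w * ddu G) ⟨φ x, hmaps x hx⟩ := by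
  have h : iteratedDeriv n φ =ᶠ[nhds x] fun y => G.lift (φ y) := by
    filter_upwards [hI.mem_nhds hx] with y hy
    rw [hG y hy, ← G.lift_apply]
  rw [iteratedDeriv_succ, h.deriv_eq, (G.hasDerivAt_lift_comp (hmaps x hx) (hφ x hx)).deriv,
    hw x hx, SmoothFun.mul_apply, mul_comm]

/-- A solution `φ` of `c(φ) f'(φ) = x` is a critical point of `S_f` at `t = 0`. -/
theorem evalAt_euler_densityS (c p s r q f f₁ f₂ : SmoothFun U) (lam : ℝ)
    (hc : ∀ v : U, c v ≠ 0) (hp : p = (3 / 5 : ℝ) • (c * ddu c) + lam • c ^ 3)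
    (hr : ddu r = c⁻¹ʳ) (φ : ℝ → ℝ) (I : Set ℝ) (hI : IsOpen I) (hφ : ContDiffOn ℝ ∞ φ I)
    (hmaps : ∀ x ∈ I, φ x ∈ U) (hsurj : ∀ v ∈ U, ∃ x ∈ I, φ x = v)
    (hX : ∀ (x : ℝ) (hx : x ∈ I), c ⟨φ x, hmaps x hx⟩ * ddu f ⟨φ x, hmaps x hx⟩ = x)
    (hf₁ : ddu f₁ = (1 / 2 : ℝ) • (c⁻¹ʳ * dn 2 (c * recip c f)))
    (hf₂ : ddu f₂ = c⁻¹ʳ * dn 2 (fHat₂ c p s f)) (x : ℝ) (hx : x ∈ I) (e : ℝ) :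
    evalAt φ x 0 e (hmaps x hx) (euler (densityS c p s r q f f₁ f₂ lam)) = 0 := by
  have hdiff : ∀ x ∈ I, DifferentiableAt ℝ φ x := fun x hx =>
    (hφ.contDiffAt (hI.mem_nhds hx)).differentiableAt (by simp)
  -- Chain rule applied to `c(φ(x)) f'(φ(x)) = x`.
  have hone : ∀ (x : ℝ) (hx : x ∈ I),
      ddu (c * ddu f) ⟨φ x, hmaps x hx⟩ * deriv φ x = 1 := by
    intro x hx
    have h : (fun y => (c * ddu f).lift (φ y)) =ᶠ[nhds x] fun y => y := by
      filter_upwards [hI.mem_nhds hx] with y hy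
      rw [(c * ddu f).lift_apply ⟨φ y, hmaps y hy⟩]
      exact hX y hy
    rw [← ((c * ddu f).hasDerivAt_lift_comp (hmaps x hx) (hdiff x hx)).deriv, h.deriv_eq,
      deriv_id'']
  -- Surjectivity of `φ` onto `U` carries the nonvanishing from the points `φ(x)` to all of `U`, so
  -- that `w` is a genuine reciprocal.
  have hw : ∀ v : U, ddu (c * ddu f) v ≠ 0 := by
    rintro ⟨v, hv⟩ h0
    obtain ⟨y, hy, rfl⟩ := hsurj v hv
    have := hone y hy
    rw [h0, zero_mul] at this
    exact zero_ne_one this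
  have hd : ∀ (x : ℝ) (hx : x ∈ I), deriv φ x = recip c f ⟨φ x, hmaps x hx⟩ := by
    intro x hx
    rw [recip, (SmoothFun.inverse_apply _ hw).2]
    exact eq_inv_of_mul_eq_one_right (hone x hx)
  have hstep := iteratedDeriv_succ_eq hI hdiff hmaps (recip c f)
  have d1 : ∀ (x : ℝ) (hx : x ∈ I), iteratedDeriv 1 φ x = recip c f ⟨φ x, hmaps x hx⟩ := by
    intro x hx
    rw [iteratedDeriv_one, hd x hx]
  have d2 := hstep _ hd 1 d1
  have d3 := hstep _ hd 2 d2
  have d4 := hstep _ hd 3 d3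
  obtain ⟨ρ, hρ, hρe, hρx, hρt, hρu⟩ : ∃ ρ : JetVar → ℝ,
      evalAt φ x 0 e (hmaps x hx) = evalJet ⟨φ x, hmaps x hx⟩ ρ ∧ ρ JetVar.eps = e ∧
      ρ JetVar.x = x ∧ ρ JetVar.t = 0 ∧ ∀ k, ρ (JetVar.jet k) = iteratedDeriv (k + 1) φ x :=
    ⟨_, rfl, rfl, rfl, rfl, fun _ => rfl⟩
  have h2 := stationary_eps_two c r f f₁ hc hw hr hf₁ ⟨φ x, hmaps x hx⟩ ρ
    ((hρu 0).trans (d1 x hx)) ((hρu 1).trans (d2 x hx))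
  have h4 := stationary_eps_four c p s r f f₁ f₂ lam hc hw hp hr hf₁ hf₂ ⟨φ x, hmaps x hx⟩ ρ
    ((hρu 0).trans (d1 x hx)) ((hρu 1).trans (d2 x hx)) ((hρu 2).trans (d3 x hx))
    ((hρu 3).trans (d4 x hx))
  -- Order `ε⁰`: `f' = (c f') / c` with `c f' = x` along `φ`.
  have h0 : ddu f ⟨φ x, hmaps x hx⟩ = x * ddu r ⟨φ x, hmaps x hx⟩ := by
    have := congrArg (fun a : SmoothFun U => a ⟨φ x, hmaps x hx⟩) (ddu_eq_mul_inverse c f hc)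
    simp only [SmoothFun.mul_apply, hX x hx] at this
    rw [hr]
    exact this
  rw [SmoothFun.mul_apply, hX x hx] at h2 h4
  rw [hρ, euler_densityS, euler_dopTrunc, euler_dop, euler_dop]
  simp only [map_add, map_sub, map_mul, map_pow, evalJet_C, evalJet_X, hρe, hρx, hρt]
    at h2 h4 ⊢
  linear_combination -h0 + e ^ 2 * h2 + e ^ 4 * h4

end StringEq

end

theorem mainTheorem6 (U : TopologicalSpace.Opens ℝ)
    (h c p s r q f f₁ f₂ : StringEq.SmoothFun U) (lam : ℝ)
    (hc : ∀ v : U, c v ≠ 0)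
    (hp : p = (3 / 5 : ℝ) • (c * StringEq.ddu c) + lam • c ^ 3)
    (hr : StringEq.ddu r = c⁻¹ʳ)
    (hq : StringEq.ddu q = StringEq.dn 2 h * c⁻¹ʳ) :
    (∃ R : StringEq.DiffPoly U,
      StringEq.partialT (StringEq.euler (StringEq.densityS c p s r q f f₁ f₂ lam))
        + StringEq.euler
            (StringEq.euler (StringEq.densityS c p s r q f f₁ f₂ lam)
              * StringEq.totalD (StringEq.euler (StringEq.dop c p s h)))
        = StringEq.eps ^ 6 * R) ∧
    (∀ (φ : ℝ → ℝ) (I : Set ℝ) (_ : IsOpen I) (_ : ContDiffOn ℝ ∞ φ I)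
      (hmaps : ∀ x ∈ I, φ x ∈ U) (_ : ∀ v ∈ U, ∃ x ∈ I, φ x = v)
      (_ : ∀ (x : ℝ) (hx : x ∈ I),
        c ⟨φ x, hmaps x hx⟩ * StringEq.ddu f ⟨φ x, hmaps x hx⟩ = x)
      (_ : StringEq.ddu f₁ =
        (1 / 2 : ℝ) • (c⁻¹ʳ * StringEq.dn 2 (c * (StringEq.ddu (c * StringEq.ddu f))⁻¹ʳ)))
      (_ : StringEq.ddu f₂ = c⁻¹ʳ * StringEq.dn 2 (StringEq.fHat₂ c p s f)),
      ∀ (x : ℝ) (hx : x ∈ I) (e : ℝ),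
        StringEq.evalAt φ x 0 e (hmaps x hx)
          (StringEq.euler (StringEq.densityS c p s r q f f₁ f₂ lam)) = 0) := by
  refine ⟨StringEq.densityS_conserved h c p s r q f f₁ f₂ lam hc hp hr hq, ?_⟩
  intro φ I hI hφ hmaps hsurj hX hf₁ hf₂ x hx e
  -- The reciprocal written out in the hypothesis on `f₁'` is `recip c f` by definition.
  exact StringEq.evalAt_euler_densityS c p s r q f f₁ f₂ lam hc hp hr φ I hI hφ hmaps hsurj hX
    hf₁ hf₂ x hx e
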